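/- Let $\ell\ge 1$ and write $(a;q)_n=\prod_{k=0}^{n-1}(1-aq^k)$, $(q)_n=(q;q)_n$, with $1/(q)_m=0$ for $m<0$. For a profile $c=(c_1,c_2)\in\mathbb{Z}_{\ge0}^2$, a ($2$-rowed) cylindric partition of profile $c$ is a pair $\pi=(\pi^{(1)},\pi^{(2)})$ of (possibly empty) partitions with $\pi^{(1)}_j\ge\pi^{(2)}_{j+c_2}$ and $\pi^{(2)}_j\ge\pi^{(1)}_{j+c_1}$ for all $j\ge1$ (parts beyond the last one being $0$). It is tight if for every integer $j\ge 1$ at least one of $\pi^{(1)},\pi^{(2)}$ does not contain $j$ as a part. Let $T_c(z,q)=\sum_{\pi}z^{\max(\pi)}q^{\mathrm{wt}(\pi)}\in\mathbb{Z}[[z,q]]$, where $\pi$ runs over the tight cylindric partitions of profile $c$, $\max(\pi)$ is the largest part ($0$ if $\pi$ is empty) and $\mathrm{wt}(\pi)$ is the sum of all parts. All identities below are between formal power series in $z,q$, and all sums converge as such. (i) For $0\le b\le\lfloor \ell/2\rfloor$, \begin{align*} T_{(\ell-b,b)}(z,q)&=T_{(b,\ell-b)}(z,q)\\ &=\sum_{n_1,\dots,n_\ell\ge0}\frac{z^{N_1}q^{\frac12(N_1^2+\cdots+N_\ell^2)+\frac12(n_1+n_3+\cdots+n_{2b-1})+\frac12(N_{2b+1}+N_{2b+2}+\cdots+N_\ell)}\,(q)_{N_1}}{(zq;q)_{N_1}(q)_{n_1}\cdots(q)_{n_\ell}}\\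 &=\sum_{N_1,\dots,N_\ell\ge0}\frac{z^{N_1}q^{\sum_{i=1}^{\ell}\binom{N_i+1}{2}-\sum_{i=1}^{b}N_{2i}}\,(q)_{N_1}}{(zq;q)_{N_1}(q)_{N_1-N_2}\cdots(q)_{N_{\ell-1}-N_\ell}(q)_{N_\ell}}, \end{align*} where in the first sum $N_j=n_j+n_{j+1}+\cdots+n_\ell$. (ii) For $t\geq 0$ and a vector $\vec v=(v_1,\dots,v_\ell)\in\mathbb{Z}^\ell$ for which all exponents of $q$ below are nonnegative (which holds for the vectors $-\eta_i$ used here), put, with $N_j$ as in the first sum, $$S(t;\vec v;z,q)=\sum_{n_1,\dots,n_\ell\ge0}\frac{z^{N_1}q^{\frac12(N_1^2+\cdots+N_\ell^2+N_1+\cdots+N_\ell)+\vec v\cdot\vec n}\,(q)_{N_1}}{(zq;q)_{N_1+t}(q)_{n_1}\cdots(q)_{n_\ell}},$$ let $e_j$ be the standard basis vectors, $\delta_j=e_j+e_{j+1}+\cdots+e_\ell$ (so $\delta_j=0$ for $j>\ell$), $\eta_i=\delta_2+\delta_4+\cdots+\delta_{2i}$, and $R_i(z)=R_i(z,q)=S(0;-\eta_i;z,q)$.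 Then $R_i=T_{(\ell-i,i)}$ for $0\le i\le\lfloor \ell/2\rfloor$, and the $R_i$ satisfy the diamond relations \begin{align*} R_0(z)+\frac{zq^2}{1-zq^2}R_0(zq^2)&=\frac{R_1(zq)}{1-zq},\\ R_i(z)+\frac{zq^2}{1-zq^2}R_i(zq^2)&=\frac{R_{i-1}(zq)}{1-zq}+\frac{R_{i+1}(zq)}{1-zq}-\frac{R_i(zq^2)}{1-zq^2},\qquad 1\le i<\tfrac{\ell-1}{2},\\ R_{\ell/2}(z)+\frac{zq^2}{1-zq^2}R_{\ell/2}(zq^2)&=\frac{2R_{\ell/2-1}(zq)}{1-zq}-\frac{R_{\ell/2}(zq^2)}{1-zq^2},\qquad \ell\text{ even},\\ R_{(\ell-1)/2}(z)+\frac{zq^2}{1-zq^2}R_{(\ell-1)/2}(zq^2)&=\frac{R_{(\ell-3)/2}(zq)}{1-zq}+\frac{R_{(\ell-1)/2}(zq)}{1-zq}-\frac{R_{(\ell-1)/2}(zq^2)}{1-zq^2},\qquad \ell\ge3\text{ odd} \end{align*} (for $\ell=1$ one has $\eta_1=0$, so $R_1=R_0$ in the first relation), with the initial conditions $R_i(0,q)=R_i(z,0)=1$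 for $0\le i\le\lfloor \ell/2\rfloor$. -/

import Mathlib

open scoped PowerSeries.WithPiTopology

namespace TightCylindric

/-! ### Cylindric partitions -/

/-- A cylindric partition of profile `c = (c_1, …, c_r)`. The rows are indexed by `Fin r`, where
addition is cyclic, and each row is a partition, written as a weakly decreasing finitely supported
sequence of natural numbers (so entries past the last part are `0`; the `j`-th part is the value
at `j - 1`). The interlacing condition says `π^{(i)}_j ≥ π^{(i+1)}_{j + c_{i+1}}` for all `i`,
with row `r + 1` being row `1`. -/
@[ext]
structure CylindricPartition {r : ℕ} [NeZero r] (c : Fin r → ℕ) where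
  row : Fin r → (ℕ →₀ ℕ)
  antitone_row : ∀ i, Antitone (row i)
  interlacing : ∀ (i : Fin r) (j : ℕ), row (i + 1) (j + c (i + 1)) ≤ row i j

namespace CylindricPartition

variable {r : ℕ} [NeZero r] {c : Fin r → ℕ}

/-- `π` is tight: every positive integer `j` fails to be a part of at least one of the rows. -/
def IsTight (π : CylindricPartition c) : Prop :=
  ∀ j : ℕ, 0 < j → ∃ i : Fin r, ∀ k : ℕ, π.row i k ≠ j

/-- The largest part (`0` for the empty cylindric partition); the largest part of a row is its
first entry. -/
def largestPart (π : CylindricPartition c) : ℕ :=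
  Finset.univ.sup fun i => π.row i 0

/-- The weight: the sum of all entries of all rows. -/
def weight (π : CylindricPartition c) : ℕ :=
  ∑ i, (π.row i).sum fun _ a => a

end CylindricPartition

/-- The set of tight cylindric partitions of profile `c`. -/
abbrev Tight {r : ℕ} [NeZero r] (c : Fin r → ℕ) : Type :=
  {π : CylindricPartition c // π.IsTight}

/-! ### Formal power series in `z` and `q` -/

/-- The ring `ℤ⟦z, q⟧`, as power series in `z` over `ℤ⟦q⟧`. With the (product) topology of
coefficientwise convergence, where `ℤ` is discrete, `HasSum` is convergence of formal sums. -/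
abbrev ZQ : Type := PowerSeries (PowerSeries ℤ)

/-- The variable `z`. -/
noncomputable def z : ZQ := PowerSeries.X

/-- The variable `q`. -/
noncomputable def q : ZQ := PowerSeries.C PowerSeries.X

/-- The finite `q`-Pochhammer symbol `(a; q)_n = ∏_{k=0}^{n-1} (1 - a q^k)`. -/
noncomputable def qPoch (a : ZQ) (n : ℕ) : ZQ :=
  ∏ k ∈ Finset.range n, (1 - a * q ^ k)

theorem isUnit_one_sub {a : ZQ} (h : PowerSeries.constantCoeff (PowerSeries.constantCoeff a) = 0) :
    IsUnit (1 - a) := by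
  rw [PowerSeries.isUnit_iff_constantCoeff, PowerSeries.isUnit_iff_constantCoeff]
  simp [h]

/-- The denominators `(q)_n` are invertible. -/
theorem isUnit_qPoch_q (n : ℕ) : IsUnit (qPoch q n) := by
  unfold qPoch
  induction n with
  | zero => simp
  | succ n ih =>
    rw [Finset.prod_range_succ]
    exact ih.mul (isUnit_one_sub (by simp [q]))

/-- The denominators `(zq; q)_n` are invertible. -/
theorem isUnit_qPoch_zq (n : ℕ) : IsUnit (qPoch (z * q) n) := by
  unfold qPoch
  induction n with
  | zero => simp
  | succ n ih =>
    rw [Finset.prod_range_succ]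
    exact ih.mul (isUnit_one_sub (by simp [z, q]))

/-- The denominators `1 - z q^k` are invertible. -/
theorem isUnit_one_sub_zq (k : ℕ) : IsUnit (1 - z * q ^ k) :=
  isUnit_one_sub (by simp [z])

/-- `1 / (q)_m`, with the usual convention that it is `0` for negative `m`. -/
noncomputable def invQ (m : ℤ) : ZQ :=
  if 0 ≤ m then Ring.inverse (qPoch q m.toNat) else 0

/-- `F(z, q) ↦ F(z q^k, q)`. -/
noncomputable def shiftZ (k : ℕ) (F : ZQ) : ZQ :=
  PowerSeries.rescale (PowerSeries.X ^ k) F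

/-- The term `z^{max(π)} q^{wt(π)}`. -/
noncomputable def tightTerm {r : ℕ} [NeZero r] (c : Fin r → ℕ) (π : Tight c) : ZQ :=
  z ^ π.1.largestPart * q ^ π.1.weight

/-- The generating function `T_c(z, q)` of tight cylindric partitions of profile `c`. -/
noncomputable def T {r : ℕ} [NeZero r] (c : Fin r → ℕ) : ZQ :=
  ∑' π : Tight c, tightTerm c π

/-! ### The multisums -/

/-- The `j`-th coordinate (`1 ≤ j ≤ ℓ`) of the vector `(v_1, …, v_ℓ)`, and `0` for other `j`. -/
def coord {ℓ : ℕ} (v : Fin ℓ → ℕ) (j : ℕ) : ℕ :=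
  if h : 1 ≤ j ∧ j ≤ ℓ then v ⟨j - 1, by omega⟩ else 0

/-- `N_j = n_j + n_{j+1} + ⋯ + n_ℓ`. -/
def bigN {ℓ : ℕ} (n : Fin ℓ → ℕ) (j : ℕ) : ℕ :=
  ∑ i ∈ Finset.Icc j ℓ, coord n i

/-- Twice the exponent of `q` in the `n`-form of the multisum:
`(N_1² + ⋯ + N_ℓ²) + (n_1 + n_3 + ⋯ + n_{2b-1}) + (N_{2b+1} + N_{2b+2} + ⋯ + N_ℓ)`. -/
def twiceExponent {ℓ : ℕ} (b : ℕ) (n : Fin ℓ → ℕ) : ℕ :=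
  (∑ j ∈ Finset.Icc 1 ℓ, bigN n j ^ 2) + (∑ i ∈ Finset.Icc 1 b, coord n (2 * i - 1)) +
    ∑ j ∈ Finset.Icc (2 * b + 1) ℓ, bigN n j

/-- The summand indexed by `(n_1, …, n_ℓ)` of the `n`-form of the multisum. -/
noncomputable def smallNTerm (ℓ b : ℕ) (n : Fin ℓ → ℕ) : ZQ :=
  z ^ bigN n 1 * q ^ (twiceExponent b n / 2) * qPoch q (bigN n 1) *
    (Ring.inverse (qPoch (z * q) (bigN n 1)) * ∏ j ∈ Finset.Icc 1 ℓ, invQ (coord n j))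

/-- The summand indexed by `(N_1, …, N_ℓ)` of the `N`-form of the multisum. -/
noncomputable def bigNTerm (ℓ b : ℕ) (N : Fin ℓ → ℕ) : ZQ :=
  z ^ coord N 1 *
    q ^ ((∑ i ∈ Finset.Icc 1 ℓ, (coord N i + 1).choose 2) -
      ∑ i ∈ Finset.Icc 1 b, coord N (2 * i)) *
    qPoch q (coord N 1) *
    (Ring.inverse (qPoch (z * q) (coord N 1)) *
      ((∏ j ∈ Finset.Icc 1 (ℓ - 1), invQ ((coord N j : ℤ) - (coord N (j + 1) : ℤ))) *
        invQ (coord N ℓ)))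

/-- `δ_j = e_j + e_{j+1} + ⋯ + e_ℓ`, which is `0` for `j > ℓ`. -/
def deltaVec (ℓ j : ℕ) : Fin ℓ → ℤ := fun k => if j ≤ (k : ℕ) + 1 then 1 else 0

/-- `η_i = δ_2 + δ_4 + ⋯ + δ_{2i}`. -/
def etaVec (ℓ i : ℕ) : Fin ℓ → ℤ := ∑ k ∈ Finset.Icc 1 i, deltaVec ℓ (2 * k)

/-- The exponent of `q` in the summand of `S(t; v; z, q)`:
`(N_1² + ⋯ + N_ℓ² + N_1 + ⋯ + N_ℓ)/2 + v · n`. -/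
def sExponent {ℓ : ℕ} (v : Fin ℓ → ℤ) (n : Fin ℓ → ℕ) : ℤ :=
  (((∑ j ∈ Finset.Icc 1 ℓ, (bigN n j ^ 2 + bigN n j)) / 2 : ℕ) : ℤ) + ∑ k, v k * (n k : ℤ)

/-- The summand of `S(t; v; z, q)` indexed by `n = (n_1, …, n_ℓ)`, for vectors `v` for which the
exponents of `q` are nonnegative. -/
noncomputable def sTerm (ℓ t : ℕ) (v : Fin ℓ → ℤ) (n : Fin ℓ → ℕ) : ZQ :=
  z ^ bigN n 1 * q ^ (sExponent v n).toNat * qPoch q (bigN n 1) *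
    (Ring.inverse (qPoch (z * q) (bigN n 1 + t)) * ∏ j ∈ Finset.Icc 1 ℓ, invQ (coord n j))

/-- `S(t; v; z, q)`. -/
noncomputable def S (ℓ t : ℕ) (v : Fin ℓ → ℤ) : ZQ := ∑' n : Fin ℓ → ℕ, sTerm ℓ t v n

/-! ### The exponents are well defined -/

/-- No truncation takes place in the exponent of `q` in the `N`-form. -/
theorem sum_even_le_sum_choose {ℓ : ℕ} (b : ℕ) (f : ℕ → ℕ) (hb : b ≤ ℓ / 2) :
    ∑ i ∈ Finset.Icc 1 b, f (2 * i) ≤ ∑ i ∈ Finset.Icc 1 ℓ, (f i + 1).choose 2 := by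
  have hinj : Set.InjOn (fun i : ℕ => 2 * i) (Finset.Icc 1 b : Finset ℕ) := by
    intro x _ y _ h
    simpa using h
  have hle : ∀ m : ℕ, m ≤ (m + 1).choose 2 := fun m => by
    rw [Nat.choose_succ_succ' m 1, Nat.choose_one_right]; omega
  calc ∑ i ∈ Finset.Icc 1 b, f (2 * i)
      = ∑ i ∈ (Finset.Icc 1 b).image (fun i => 2 * i), f i := (Finset.sum_image hinj).symm
    _ ≤ ∑ i ∈ Finset.Icc 1 ℓ, f i := by
        refine Finset.sum_le_sum_of_subset ?_
        intro x hx
        simp only [Finset.mem_image, Finset.mem_Icc] at hx ⊢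
        omega
    _ ≤ _ := Finset.sum_le_sum fun i _ => hle _

theorem bigN_eq_coord_add {ℓ : ℕ} (n : Fin ℓ → ℕ) {j : ℕ} (h : j ≤ ℓ) :
    bigN n j = coord n j + bigN n (j + 1) := by
  unfold bigN
  rw [← Finset.insert_Icc_add_one_left_eq_Icc h, Finset.sum_insert (by simp)]

/-- The exponent of `q` in the `n`-form is an integer. -/
theorem even_twiceExponent {ℓ b : ℕ} (hb : b ≤ ℓ / 2) (n : Fin ℓ → ℕ) :
    Even (twiceExponent b n) := by
  have h1 : ∀ b, b ≤ ℓ / 2 → Even ((∑ j ∈ Finset.Icc 1 (2 * b), bigN n j) +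
      ∑ i ∈ Finset.Icc 1 b, coord n (2 * i - 1)) := by
    intro b
    induction b with
    | zero => simp
    | succ b ih =>
      intro hb
      have := ih (by omega)
      rw [show 2 * (b + 1) = 2 * b + 1 + 1 by ring, Finset.sum_Icc_succ_top (by omega),
        Finset.sum_Icc_succ_top (by omega), Finset.sum_Icc_succ_top (by omega),
        bigN_eq_coord_add n (show 2 * b + 1 ≤ ℓ by omega),
        show 2 * (b + 1) - 1 = 2 * b + 1 by omega]
      obtain ⟨k, hk⟩ := this
      exact ⟨k + coord n (2 * b + 1) + bigN n (2 * b + 1 + 1), by omega⟩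
  have h2 : Even (∑ j ∈ Finset.Icc 1 ℓ, (bigN n j ^ 2 + bigN n j)) :=
    Finset.even_sum _ fun i _ => by
      rw [pow_two, ← Nat.mul_add_one]; exact Nat.even_mul_succ_self _
  have h3 : ∑ j ∈ Finset.Icc 1 ℓ, bigN n j =
      (∑ j ∈ Finset.Icc 1 (2 * b), bigN n j) + ∑ j ∈ Finset.Icc (2 * b + 1) ℓ, bigN n j := by
    rw [← Finset.sum_union]
    · congr 1
      ext x
      simp only [Finset.mem_union, Finset.mem_Icc]
      omega
    · rw [Finset.disjoint_left]
      intro x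
      simp only [Finset.mem_Icc]
      omega
  obtain ⟨k, hk⟩ := h1 b hb
  obtain ⟨m, hm⟩ := h2
  rw [Finset.sum_add_distrib, h3] at hm
  unfold twiceExponent
  rw [Nat.even_iff]
  omega

theorem deltaVec_dot {ℓ : ℕ} (j : ℕ) (hj : 1 ≤ j) (n : Fin ℓ → ℕ) :
    ∑ k, deltaVec ℓ j k * (n k : ℤ) = bigN n j := by
  have h : bigN n j = ∑ k : Fin ℓ, if j ≤ (k : ℕ) + 1 then n k else 0 := by
    rw [← Finset.sum_filter]
    unfold bigN
    symm
    refine Finset.sum_bij (fun k _ => (k : ℕ) + 1) ?_ ?_ ?_ ?_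
    · intro k hk
      have := k.2
      simp only [Finset.mem_filter, Finset.mem_univ, true_and] at hk
      simp only [Finset.mem_Icc]
      omega
    · intro x _ y _ h
      exact Fin.ext (by simpa using h)
    · intro x hx
      simp only [Finset.mem_Icc] at hx
      refine ⟨⟨x - 1, by omega⟩, ?_, ?_⟩
      · simp only [Finset.mem_filter, Finset.mem_univ, true_and]
        omega
      · simp only
        omega
    · intro k _
      have := k.2
      simp [coord, Nat.succ_le_of_lt this]
  rw [h]
  push_cast
  exact Finset.sum_congr rfl fun k _ => by simp [deltaVec]

/-- For `v = -η_i` the exponent of `q` in the summand of `S(t; v; z, q)` is nonnegative. -/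
theorem sExponent_neg_eta_nonneg {ℓ i : ℕ} (hi : i ≤ ℓ / 2) (n : Fin ℓ → ℕ) :
    0 ≤ sExponent (-etaVec ℓ i) n := by
  have h1 : ∑ k, (-etaVec ℓ i) k * (n k : ℤ) =
      -((∑ k ∈ Finset.Icc 1 i, bigN n (2 * k) : ℕ) : ℤ) := by
    push_cast
    have : ∀ m ∈ Finset.Icc 1 i, (bigN n (2 * m) : ℤ) = ∑ k, deltaVec ℓ (2 * m) k * (n k : ℤ) :=
      fun m hm => (deltaVec_dot _ (by simp only [Finset.mem_Icc] at hm; omega) n).symm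
    rw [Finset.sum_congr rfl this, Finset.sum_comm, ← Finset.sum_neg_distrib]
    refine Finset.sum_congr rfl fun k _ => ?_
    simp [etaVec, Finset.sum_mul]
  have h2 : (∑ j ∈ Finset.Icc 1 ℓ, (bigN n j ^ 2 + bigN n j)) / 2 =
      ∑ j ∈ Finset.Icc 1 ℓ, (bigN n j + 1).choose 2 := by
    refine Nat.div_eq_of_eq_mul_left two_pos ?_
    rw [Finset.sum_mul]
    refine Finset.sum_congr rfl fun j _ => ?_
    rw [Nat.choose_two_right, Nat.div_mul_cancel, Nat.add_sub_cancel]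
    · ring
    · rw [Nat.add_sub_cancel, mul_comm]
      exact (Nat.even_mul_succ_self _).two_dvd
  have h3 := sum_even_le_sum_choose i (bigN n) hi
  unfold sExponent
  rw [h1, h2]
  omega

/-! ### The diamond relations -/

/-- `F(z q^k, q) / (1 - z q^k)`. -/
noncomputable def shiftDiv (k : ℕ) (F : ZQ) : ZQ :=
  shiftZ k F * Ring.inverse (1 - z * q ^ k)

/-- The left-hand side `F(z) + (z q² / (1 - z q²)) F(z q²)` of the diamond relations. -/
noncomputable def diamondLHS (F : ZQ) : ZQ :=
  F + z * q ^ 2 * Ring.inverse (1 - z * q ^ 2) * shiftZ 2 F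

/-- The two-rowed diamond relations at level `ℓ` for the series `R_0, R_1, …, R_⌊ℓ/2⌋`
(and `R_1` in the case `ℓ = 1`). -/
structure DiamondRelations (ℓ : ℕ) (R : ℕ → ZQ) : Prop where
  edge : diamondLHS (R 0) = shiftDiv 1 (R 1)
  interior : ∀ i, 1 ≤ i → 2 * i + 1 < ℓ →
    diamondLHS (R i) = shiftDiv 1 (R (i - 1)) + shiftDiv 1 (R (i + 1)) - shiftDiv 2 (R i)
  middle_even : Even ℓ →
    diamondLHS (R (ℓ / 2)) = 2 * shiftDiv 1 (R (ℓ / 2 - 1)) - shiftDiv 2 (R (ℓ / 2))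
  middle_odd : Odd ℓ → 3 ≤ ℓ →
    diamondLHS (R ((ℓ - 1) / 2)) =
      shiftDiv 1 (R ((ℓ - 3) / 2)) + shiftDiv 1 (R ((ℓ - 1) / 2)) - shiftDiv 2 (R ((ℓ - 1) / 2))

end TightCylindric

/-! Both sides are computed as (1 - z) ∑ w_d(M) z^M, with w_d(M) the generating function of tight
cylindric partitions of profile (d, ℓ - d) with all parts at most M.

Combinatorial side. By tightness only one row contains the part M. Deleting its copies, k in number,
moves the profile from (d, ℓ - d) to (e, ℓ - e) with |d - e| = k, and every e in {0, …, ℓ} arises.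
Hence w_d(M) = ∑_e q^{M|d-e|} w_e(M - 1) (`mem_tightPairs`, `sum_tightPairs`).

Multisum side. Since z^N (q)_N / (zq)_N = (1 - z) ∑_M (q)_M / (q)_{M-N} z^M (`pow_mul_qPoch_eq`),
the multisum with parameter b is (1 - z) ∑ (q)_M f_b(M) z^M, where f_b = P^b B^{ℓ-2b} (1/(q)_n).
Here X is multiplication by q^n, D the shift, B convolution with 1/(q)_n after weighting by
q^{N(N+1)/2}, and P = B B X⁻¹.

Comparison. Put f_{ℓ-d} = f_d. What is needed is (1 - x) f_d(M) = ∑_e x^{|d-e|} f_e(M - 1) with x =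
q^M. The matrix x^{|d-e|} has a tridiagonal inverse (`tridiagonal_solution`), so this amounts to
three-term relations in d with two boundary relations. These follow from XB = (1 - D)BX and DB =
BX⁻¹D: P intertwines the operators in the relation (`diamond_operator_identity`), which reduces
every d to a base case.

The diamond relations are the same three-term relations, read off coefficientwise in z. Powers of
q⁻¹ force the computation into the fraction field of ℤ⟦q⟧. -/

namespace TightCylindric

/-! ### The operator identities behind the diamond relations -/

section Operators

variable {A : Type*} [Ring A] {X Xi D B : A}

theorem mul_mul_inv_of_comm (h1 : X * B = (1 - D) * B * X) (h3 : X * Xi = 1) :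
    X * B * Xi = (1 - D) * B := by
  rw [h1, mul_assoc, h3, mul_one]

/-- Conjugation by X turns each B into (1 - D)B, so the left side is BB - (1 - D)B(1 - D)B = DBB +
XBX⁻¹DB, and X⁻¹D moves back through B by BX⁻¹D = DB. -/
theorem edge_operator_identity (h1 : X * B = (1 - D) * B * X) (h2 : D * B = B * Xi * D)
    (h3 : X * Xi = 1) :
    B * B - X * (B * (B * Xi)) = (1 + X) * (D * (B * B)) := by
  have h5 := mul_mul_inv_of_comm h1 h3
  linear_combination (norm := noncomm_ring)
    -h1 * B * Xi - (1 - D) * B * h5 - X * h2 * B - h5 * D * B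

/-- Let P = BBX⁻¹, L = 1 + X² - (1 + X)D and Y = X - (1 + X⁻¹)D. Then XP = PY, (1 + X)DP = P(1 +
X⁻¹)DX⁻¹ and X⁻¹L = Y + X⁻¹, so both sides equal PY(Y + X⁻¹). -/
theorem diamond_operator_identity (h1 : X * B = (1 - D) * B * X) (h2 : D * B = B * Xi * D)
    (h3 : X * Xi = 1) (h4 : Xi * X = 1) :
    X * (B * B * Xi) * Xi * (1 + X * X - (1 + X) * D) =
      (1 + X * X - (1 + X) * D) * (B * B * Xi) := by
  have h5 := mul_mul_inv_of_comm h1 h3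
  have h7 : B * Xi = Xi * ((1 - D) * B) := by
    rw [← h5, mul_assoc X, ← mul_assoc Xi, h4, one_mul]
  -- conjugation of `X` by `B * B * Xi`
  have e1 : X * (B * B * Xi) = B * B * Xi * (X - (1 + Xi) * D) := by
    linear_combination (norm := noncomm_ring)
      h1 * B * Xi + (1 - D) * B * h5 - B * B * h4 - B * h2 - h2 * (B - D * B) -
        B * Xi * (1 - D) * h2 + B * h7 * Xi * D
  -- conjugation of `(1 + X) * D`
  have e2 : (1 + X) * D * (B * B * Xi) = B * B * Xi * ((1 + Xi) * D * Xi) := by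
    linear_combination (norm := noncomm_ring)
      (1 + X) * h2 * B * Xi + (1 + X) * B * Xi * h2 * Xi + h5 * B * Xi * D * Xi - h2 * B * Xi * D * Xi
        - B * h7 * Xi * D * Xi
  have e3 : Xi * (1 + X * X - (1 + X) * D) = X - (1 + Xi) * D + Xi := by
    linear_combination (norm := noncomm_ring) h4 * X - h4 * D
  linear_combination (norm := noncomm_ring)
    X * (B * B * Xi) * e3 + e1 * (X - (1 + Xi) * D + Xi) - X * e1 - e1 * (X - (1 + Xi) * D) + e2 +
      B * B * Xi * h3

end Operators

/-! ### Operators on sequences and their commutation relations -/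

section Sequences

variable {K : Type*} [Field K]

/-- `(q)_n` in a commutative ring. -/
def qFac {R : Type*} [CommRing R] (q : R) (n : ℕ) : R := ∏ k ∈ Finset.range n, (1 - q ^ (k + 1))

theorem qFac_succ {R : Type*} [CommRing R] (q : R) (n : ℕ) : qFac q (n + 1) = qFac q n * (1 - q ^ (n + 1)) :=
  Finset.prod_range_succ _ _

theorem map_qFac {R S : Type*} [CommRing R] [CommRing S] (f : R →+* S) (q : R) (n : ℕ) :
    f (qFac q n) = qFac (f q) n := by
  simp [qFac]

theorem qFac_ne_zero {q : K} (hq : ∀ n, q ^ (n + 1) ≠ 1) (n : ℕ) : qFac q n ≠ 0 :=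
  Finset.prod_ne_zero_iff.2 fun k _ => sub_ne_zero.2 (hq k).symm

/-- Multiplication of a sequence by `n ↦ q ^ n`. -/
def powOp (q : K) : Module.End K (ℕ → K) where
  toFun φ n := q ^ n * φ n
  map_add' _ _ := by ext; simp [mul_add]
  map_smul' _ _ := by ext; simp [mul_left_comm]

/-- The shift `φ ↦ φ(· - 1)`. -/
def shiftOp : Module.End K (ℕ → K) where
  toFun φ n := Nat.casesOn n 0 φ
  map_add' _ _ := by ext n; cases n <;> simp
  map_smul' _ _ := by ext n; cases n <;> simp

/-- The operator `φ ↦ (M ↦ ∑ N, w N φ N / (q)_{M - N})`. -/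
def convOp (q : K) (w : ℕ → K) : Module.End K (ℕ → K) where
  toFun φ M := ∑ N ∈ Finset.range (M + 1), w N * φ N / qFac q (M - N)
  map_add' _ _ := by ext; simp [mul_add, add_div, Finset.sum_add_distrib]
  map_smul' _ _ := by
    ext
    simp only [Pi.smul_apply, smul_eq_mul, RingHom.id_apply, Finset.mul_sum]
    exact Finset.sum_congr rfl fun _ _ => by ring

/-- The weight `q ^ (N(N+1)/2)`. -/
def triWeight (q : K) (N : ℕ) : K := q ^ (N + 1).choose 2

theorem powOp_apply (q : K) (φ : ℕ → K) (n : ℕ) : powOp q φ n = q ^ n * φ n := rfl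
@[simp] theorem shiftOp_zero (φ : ℕ → K) : shiftOp φ 0 = 0 := rfl
@[simp] theorem shiftOp_succ (φ : ℕ → K) (n : ℕ) : shiftOp φ (n + 1) = φ n := rfl
theorem convOp_apply (q : K) (w φ : ℕ → K) (M : ℕ) :
    convOp q w φ M = ∑ N ∈ Finset.range (M + 1), w N * φ N / qFac q (M - N) := rfl

theorem powOp_mul_powOp_inv {q : K} (h0 : q ≠ 0) : powOp q * powOp q⁻¹ = 1 := by
  ext φ n
  simp [Module.End.mul_apply, powOp_apply, h0]

theorem powOp_inv_mul_powOp {q : K} (h0 : q ≠ 0) : powOp q⁻¹ * powOp q = 1 := by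
  ext φ n
  simp [Module.End.mul_apply, powOp_apply, h0]

/-- Termwise this is q^k / (q)_k = 1/(q)_k - 1/(q)_{k-1} with k = M - N, so any weight is allowed.
-/
theorem powOp_mul_convOp {q : K} (hq : ∀ n, q ^ (n + 1) ≠ 1) (w : ℕ → K) :
    powOp q * convOp q w = (1 - shiftOp) * convOp q w * powOp q := by
  refine LinearMap.ext fun φ => funext fun M => ?_
  simp only [Module.End.mul_apply, LinearMap.sub_apply, Module.End.one_apply, Pi.sub_apply]
  rw [powOp_apply]
  cases M with
  | zero => simp [convOp_apply, powOp_apply]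
  | succ M =>
    rw [shiftOp_succ]
    simp only [convOp_apply, powOp_apply]
    rw [Finset.sum_range_succ, Finset.sum_range_succ (n := M + 1), mul_add, Finset.mul_sum,
      add_sub_right_comm, ← Finset.sum_sub_distrib]
    congr 1
    · refine Finset.sum_congr rfl fun N hN => ?_
      have hN' : N ≤ M := by simpa [Nat.lt_succ_iff] using hN
      obtain ⟨k, rfl⟩ := Nat.exists_eq_add_of_le hN'
      rw [show N + k + 1 - N = k + 1 by omega, show N + k - N = k by omega, qFac_succ]
      have := qFac_ne_zero hq k
      have := sub_ne_zero.2 (hq k).symm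
      field_simp
      ring
    · ring

/-- Here the triangular weight matters: shifting N by one multiplies it by q^{N+1}, which the factor
q⁻¹ ^ (N + 1) removes. -/
theorem shiftOp_mul_convOp_tri {q : K} (h0 : q ≠ 0) :
    shiftOp * convOp q (triWeight q) = convOp q (triWeight q) * powOp q⁻¹ * shiftOp := by
  refine LinearMap.ext fun φ => funext fun M => ?_
  simp only [Module.End.mul_apply]
  cases M with
  | zero => simp [convOp_apply, powOp_apply]
  | succ M =>
    rw [shiftOp_succ, convOp_apply, convOp_apply]
    conv_rhs => rw [Finset.sum_range_succ']
    simp only [powOp_apply, shiftOp_succ, shiftOp_zero, mul_zero, zero_div, add_zero,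
      Nat.add_sub_add_right]
    refine Finset.sum_congr rfl fun N _ => ?_
    have : (N + 1 + 1).choose 2 = (N + 1).choose 2 + (N + 1) := by
      rw [Nat.choose_succ_succ' (N + 1) 1, Nat.choose_one_right, add_comm]
    unfold triWeight
    rw [this, pow_add, inv_pow]
    field_simp

end Sequences

/-! ### The multisum sequences and their three-term relations -/

section MultisumSequences

variable {K : Type*} [Field K]

/-- The sequence `1 / (q)_n`. -/
def invFac (q : K) (n : ℕ) : K := (qFac q n)⁻¹

/-- `φ ↦ (M ↦ ∑ N, q ^ (N(N+1)/2) φ N / (q)_{M - N})`. -/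
def triOp (q : K) : Module.End K (ℕ → K) := convOp q (triWeight q)

/-- Two consecutive convolutions, the inner one with weight `q ^ (N(N-1)/2)`. -/
def pairOp (q : K) : Module.End K (ℕ → K) := triOp q * triOp q * powOp q⁻¹

/-- The coefficient sequence `M ↦ f_b(M)` of the multisum with parameters `ℓ, b`. -/
def multisumSeq (q : K) (ℓ b : ℕ) : ℕ → K := (pairOp q ^ b * triOp q ^ (ℓ - 2 * b)) (invFac q)

/-- The left-hand operator `1 + X² - (1 + X) D` of the diamond relations. -/
def diamondOp (q : K) : Module.End K (ℕ → K) :=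
  1 + powOp q * powOp q - (1 + powOp q) * shiftOp

theorem triOp_single (q : K) : triOp q (Pi.single 0 1) = invFac q := by
  funext M
  rw [triOp, convOp_apply, Finset.sum_range_succ']
  simp [triWeight, invFac]

theorem powOp_single (q : K) : powOp q (Pi.single 0 1) = (Pi.single 0 1 : ℕ → K) := by
  funext M
  cases M <;> simp [powOp_apply]

theorem diamondOp_apply (q : K) (φ : ℕ → K) (n : ℕ) :
    diamondOp q φ (n + 1) =
      (1 + q ^ (n + 1) * q ^ (n + 1)) * φ (n + 1) - (1 + q ^ (n + 1)) * φ n := by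
  simp only [diamondOp, LinearMap.sub_apply, LinearMap.add_apply, Module.End.mul_apply,
    Module.End.one_apply, Pi.sub_apply, Pi.add_apply, powOp_apply, shiftOp_succ]
  ring

variable {q : K} (h0 : q ≠ 0) (hq : ∀ n, q ^ (n + 1) ≠ 1)
include h0 hq

/-- The induction step in d: `pairOp` preserves the relation that ties a sequence `b` to the sum `s`
of its two neighbours. -/
theorem diamond_pairOp {s b : ℕ → K} (h : powOp q s = diamondOp q b) :
    powOp q (pairOp q s) = diamondOp q (pairOp q b) := by
  have key := diamond_operator_identity (powOp_mul_convOp hq (triWeight q))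
    (shiftOp_mul_convOp_tri h0) (powOp_mul_powOp_inv h0) (powOp_inv_mul_powOp h0)
  have e := LinearMap.congr_fun key b
  change (powOp q * pairOp q * powOp q⁻¹) (diamondOp q b) = diamondOp q (pairOp q b) at e
  rw [← e, ← h, ← Module.End.mul_apply (powOp q * pairOp q * powOp q⁻¹),
    mul_assoc _ (powOp q⁻¹), powOp_inv_mul_powOp h0, mul_one, Module.End.mul_apply]

theorem diamond_pairOp_pow {s b : ℕ → K} (h : powOp q s = diamondOp q b) (i : ℕ) :
    powOp q ((pairOp q ^ i) s) = diamondOp q ((pairOp q ^ i) b) := by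
  induction i with
  | zero => simpa using h
  | succ i ih =>
    rw [pow_succ', Module.End.mul_apply, Module.End.mul_apply]
    exact diamond_pairOp h0 hq ih

theorem edge_pairOp (k : ℕ → K) :
    triOp q (triOp q k) - powOp q (pairOp q k) =
      (1 + powOp q) (shiftOp (triOp q (triOp q k))) :=
  LinearMap.congr_fun (edge_operator_identity (powOp_mul_convOp hq (triWeight q))
    (shiftOp_mul_convOp_tri h0) (powOp_mul_powOp_inv h0)) k

/-- A rearrangement of the edge identity. After `pairOp q ^ (i + 1)` the two summands become the
neighbours on either side, because P X = B B. -/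
theorem diamond_base (k : ℕ → K) :
    powOp q (powOp q (triOp q (triOp q k)) + pairOp q k) =
      diamondOp q (triOp q (triOp q k)) := by
  have h := edge_pairOp h0 hq k
  simp only [diamondOp, LinearMap.sub_apply, LinearMap.add_apply, Module.End.mul_apply,
    Module.End.one_apply, map_add] at h ⊢
  rw [← h]
  abel

omit h0 in
-- The base case in the middle for even ℓ, where both neighbours coincide. On 1/(q)_n the shift acts
-- as 1 - X, so the diamond operator acts as 1 + X² - (1 + X)(1 - X) = 2X².
theorem diamond_invFac :
    powOp q (powOp q (invFac q) + powOp q (invFac q)) = diamondOp q (invFac q) := by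
  funext n
  have hs : shiftOp (invFac q) n = (1 - q ^ n) * invFac q n := by
    cases n with
    | zero => simp
    | succ n =>
      have := qFac_ne_zero hq n
      have := sub_ne_zero.2 (hq n).symm
      simp only [shiftOp_succ, invFac, qFac_succ]
      field_simp
  simp only [diamondOp, LinearMap.sub_apply, LinearMap.add_apply, Module.End.mul_apply,
    Module.End.one_apply, Pi.sub_apply, Pi.add_apply, powOp_apply, hs]
  ring

omit hq in
theorem pairOp_powOp (φ : ℕ → K) : pairOp q (powOp q φ) = triOp q (triOp q φ) := by
  rw [pairOp, ← Module.End.mul_apply, mul_assoc, powOp_inv_mul_powOp h0, mul_one,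
    Module.End.mul_apply]

omit hq in
theorem pairOp_pow_powOp (ℓ i m : ℕ) (h : ℓ = 2 * i + 2 + m) :
    (pairOp q ^ (i + 1)) (powOp q ((triOp q ^ m) (invFac q))) = multisumSeq q ℓ i := by
  subst h
  rw [pow_succ, Module.End.mul_apply, pairOp_powOp h0, multisumSeq,
    show 2 * i + 2 + m - 2 * i = m + 1 + 1 by omega, pow_succ', pow_succ']
  rfl

omit h0 hq in
theorem triOp_pow_succ_single (m : ℕ) :
    (triOp q ^ (m + 1)) (Pi.single 0 1) = (triOp q ^ m) (invFac q) := by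
  rw [pow_succ, Module.End.mul_apply, triOp_single]

omit h0 hq in
theorem triOp_triOp_pow_single (m : ℕ) :
    triOp q (triOp q ((triOp q ^ m) (Pi.single 0 1))) = (triOp q ^ (m + 1)) (invFac q) := by
  rw [← triOp_pow_succ_single, pow_succ', pow_succ']
  rfl

omit h0 hq in
theorem pairOp_single : pairOp q (Pi.single 0 1) = triOp q (invFac q) := by
  rw [pairOp, Module.End.mul_apply, powOp_single, Module.End.mul_apply, triOp_single]

theorem multisumSeq_edge {ℓ : ℕ} (h : 2 ≤ ℓ) :
    multisumSeq q ℓ 0 - powOp q (multisumSeq q ℓ 1) =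
      (1 + powOp q) (shiftOp (multisumSeq q ℓ 0)) := by
  obtain ⟨m, rfl⟩ := Nat.exists_eq_add_of_le h
  -- Writing 1/(q)_n as B applied to the unit sequence at 0 supplies one more factor B than the
  -- definition of `multisumSeq` displays.
  have := edge_pairOp h0 hq ((triOp q ^ (m + 1)) (Pi.single 0 1))
  rw [triOp_triOp_pow_single, triOp_pow_succ_single] at this
  simpa [multisumSeq, add_comm 2 m] using this

theorem multisumSeq_edge_one :
    multisumSeq q 1 0 - powOp q (multisumSeq q 1 0) =
      (1 + powOp q) (shiftOp (multisumSeq q 1 0)) := by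
  have := edge_pairOp h0 hq (Pi.single 0 1)
  rw [triOp_single, pairOp_single] at this
  simpa [multisumSeq] using this

theorem multisumSeq_interior {ℓ i : ℕ} (h : 2 * i + 4 ≤ ℓ) :
    powOp q (multisumSeq q ℓ i + multisumSeq q ℓ (i + 2)) =
      diamondOp q (multisumSeq q ℓ (i + 1)) := by
  obtain ⟨m, rfl⟩ := Nat.exists_eq_add_of_le h
  have := diamond_pairOp_pow h0 hq
    (diamond_base h0 hq ((triOp q ^ (m + 1)) (Pi.single 0 1))) (i + 1)
  rw [triOp_triOp_pow_single, triOp_pow_succ_single, map_add,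
    pairOp_pow_powOp h0 (2 * i + 4 + m) i _ (by omega), ← Module.End.mul_apply (pairOp q ^ (i + 1)),
    ← pow_succ] at this
  rw [multisumSeq.eq_1 q _ (i + 2), multisumSeq.eq_1 q _ (i + 1),
    show 2 * i + 4 + m - 2 * (i + 2) = m by omega,
    show 2 * i + 4 + m - 2 * (i + 1) = m + 2 by omega]
  exact this

/-- For k the unit sequence at 0, X⁻¹ fixes k, so P k = B B k: the upper neighbour is the middle
sequence itself. -/
theorem multisumSeq_middle_odd (i : ℕ) :
    powOp q (multisumSeq q (2 * i + 3) i + multisumSeq q (2 * i + 3) (i + 1)) =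
      diamondOp q (multisumSeq q (2 * i + 3) (i + 1)) := by
  have := diamond_pairOp_pow h0 hq (diamond_base h0 hq (Pi.single 0 1)) (i + 1)
  rw [triOp_single, pairOp_single, map_add, ← pow_one (triOp q),
    pairOp_pow_powOp h0 (2 * i + 3) i _ (by omega)] at this
  have e : multisumSeq q (2 * i + 3) (i + 1) =
      (pairOp q ^ (i + 1)) ((triOp q ^ 1) (invFac q)) := by
    rw [multisumSeq, show 2 * i + 3 - 2 * (i + 1) = 1 by omega]
    rfl
  rw [e]
  exact this

theorem multisumSeq_middle_even (i : ℕ) :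
    powOp q (multisumSeq q (2 * i + 2) i + multisumSeq q (2 * i + 2) i) =
      diamondOp q (multisumSeq q (2 * i + 2) (i + 1)) := by
  have := diamond_pairOp_pow h0 hq (diamond_invFac hq) (i + 1)
  rw [map_add, show invFac q = (triOp q ^ 0) (invFac q) by simp,
    pairOp_pow_powOp h0 (2 * i + 2) i _ (by omega)] at this
  have e : multisumSeq q (2 * i + 2) (i + 1) =
      (pairOp q ^ (i + 1)) ((triOp q ^ 0) (invFac q)) := by
    rw [multisumSeq, show 2 * i + 2 - 2 * (i + 1) = 0 by omega]
    rfl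
  rw [e]
  exact this

/-! ### Reflection to 0 ≤ d ≤ ℓ and inversion of the tridiagonal system -/

omit h0 hq

/-- The sequences `f_b`, `b ≤ ℓ / 2`, extended to `0 ≤ d ≤ ℓ` by reflection. -/
def foldedSeq (q : K) (ℓ d : ℕ) : ℕ → K := multisumSeq q ℓ (min d (ℓ - d))

theorem foldedSeq_sub {ℓ d : ℕ} (h : d ≤ ℓ) : foldedSeq q ℓ (ℓ - d) = foldedSeq q ℓ d := by
  rw [foldedSeq, foldedSeq, show min (ℓ - d) (ℓ - (ℓ - d)) = min d (ℓ - d) by omega]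

theorem foldedSeq_of_le {ℓ d : ℕ} (h : d ≤ ℓ / 2) : foldedSeq q ℓ d = multisumSeq q ℓ d := by
  rw [foldedSeq, min_eq_left (by omega)]

include h0 hq in
theorem foldedSeq_edge {ℓ : ℕ} (h : 1 ≤ ℓ) (M : ℕ) :
    foldedSeq q ℓ 0 (M + 1) - q ^ (M + 1) * foldedSeq q ℓ 1 (M + 1) =
      (1 + q ^ (M + 1)) * foldedSeq q ℓ 0 M := by
  have key : multisumSeq q ℓ 0 - powOp q (foldedSeq q ℓ 1) =
      (1 + powOp q) (shiftOp (multisumSeq q ℓ 0)) := by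
    rcases h.eq_or_lt with rfl | h
    · exact multisumSeq_edge_one h0 hq
    · rw [foldedSeq_of_le (d := 1) (by omega)]
      exact multisumSeq_edge h0 hq h
  have := congrFun key (M + 1)
  rw [foldedSeq_of_le (Nat.zero_le _)]
  simp only [LinearMap.add_apply, Module.End.one_apply, Pi.sub_apply, Pi.add_apply, powOp_apply,
    shiftOp_succ] at this
  rw [this]
  ring

include h0 hq in
theorem foldedSeq_interior {ℓ d : ℕ} (h : d + 2 ≤ ℓ) (M : ℕ) :
    (1 + q ^ (M + 1) * q ^ (M + 1)) * foldedSeq q ℓ (d + 1) (M + 1) -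
      q ^ (M + 1) * (foldedSeq q ℓ d (M + 1) + foldedSeq q ℓ (d + 2) (M + 1)) =
      (1 + q ^ (M + 1)) * foldedSeq q ℓ (d + 1) M := by
  have key : powOp q (foldedSeq q ℓ d + foldedSeq q ℓ (d + 2)) =
      diamondOp q (foldedSeq q ℓ (d + 1)) := by
    unfold foldedSeq
    rcases lt_trichotomy (2 * d + 2) ℓ with hd | hd | hd
    · rw [min_eq_left (by omega : d ≤ ℓ - d), min_eq_left (by omega : d + 1 ≤ ℓ - (d + 1))]
      rcases (show 2 * d + 3 ≤ ℓ by omega).eq_or_lt with rfl | hd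
      · rw [show min (d + 2) (2 * d + 3 - (d + 2)) = d + 1 by omega]
        exact multisumSeq_middle_odd h0 hq d
      · rw [min_eq_left (by omega)]
        exact multisumSeq_interior h0 hq (by omega)
    · subst hd
      rw [show min d (2 * d + 2 - d) = d by omega,
        show min (d + 1) (2 * d + 2 - (d + 1)) = d + 1 by omega,
        show min (d + 2) (2 * d + 2 - (d + 2)) = d by omega]
      exact multisumSeq_middle_even h0 hq d
    -- Past the middle, reflection swaps the two neighbours and the earlier cases apply at e.
    · obtain ⟨e, rfl⟩ := Nat.exists_eq_add_of_le h
      rw [show min d (d + 2 + e - d) = min d (e + 2) by omega,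
        show min (d + 1) (d + 2 + e - (d + 1)) = e + 1 by omega,
        show min (d + 2) (d + 2 + e - (d + 2)) = e by omega]
      rcases (show e + 1 ≤ d by omega).eq_or_lt with rfl | hd
      · rw [show min (e + 1) (e + 2) = e + 1 by omega, show e + 1 + 2 + e = 2 * e + 3 by ring,
          add_comm (multisumSeq _ _ _)]
        exact multisumSeq_middle_odd h0 hq e
      · rw [show min d (e + 2) = e + 2 by omega, add_comm]
        exact multisumSeq_interior h0 hq (by omega)
  have := congrFun key (M + 1)
  rw [diamondOp_apply, powOp_apply, Pi.add_apply] at this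
  rw [this]
  ring

/-- Inversion of a tridiagonal system: the inverse is the matrix of powers `X ^ |d - e|`. -/
theorem tridiagonal_solution {X : K} (hX : 1 + X ≠ 0) {x y : ℕ → K} {ℓ : ℕ} (hℓ : 1 ≤ ℓ)
    (hl : y 0 - X * y 1 = (1 + X) * x 0) (hr : y ℓ - X * y (ℓ - 1) = (1 + X) * x ℓ)
    (hi : ∀ d, d + 2 ≤ ℓ →
      (1 + X * X) * y (d + 1) - X * (y d + y (d + 2)) = (1 + X) * x (d + 1))
    {d : ℕ} (hd : d ≤ ℓ) :
    ∑ e ∈ Finset.range (ℓ + 1), X ^ ((d - e) + (e - d)) * x e = (1 - X) * y d := by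
  -- The sums over e ≤ d and over e > d each telescope to two terms. Adding X times the second to
  -- the first cancels y (d + 1) and leaves (1 - X²) y d.
  have left : ∀ d, d < ℓ →
      (1 + X) * ∑ e ∈ Finset.range (d + 1), X ^ (d - e) * x e = y d - X * y (d + 1) := by
    intro d
    induction d with
    | zero => intro _; simpa using hl.symm
    | succ d ih =>
      intro h
      rw [Finset.sum_range_succ]
      have e1 : ∑ e ∈ Finset.range (d + 1), X ^ (d + 1 - e) * x e =
          X * ∑ e ∈ Finset.range (d + 1), X ^ (d - e) * x e := by
        rw [Finset.mul_sum]
        refine Finset.sum_congr rfl fun e he => ?_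
        rw [Nat.succ_sub (by simpa [Nat.lt_succ_iff] using he), pow_succ']
        ring
      rw [e1, Nat.sub_self]
      linear_combination X * ih (by omega) - hi d (by omega)
  have right : ∀ m d, d + 1 + m = ℓ →
      (1 + X) * ∑ j ∈ Finset.range (m + 1), X ^ j * x (d + 1 + j) = y (d + 1) - X * y d := by
    intro m
    induction m with
    | zero => rintro d rfl; simpa using hr.symm
    | succ m ih =>
      intro d h
      rw [Finset.sum_range_succ']
      have e1 : ∑ j ∈ Finset.range (m + 1), X ^ (j + 1) * x (d + 1 + (j + 1)) =
          X * ∑ j ∈ Finset.range (m + 1), X ^ j * x (d + 1 + 1 + j) := by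
        rw [Finset.mul_sum]
        refine Finset.sum_congr rfl fun e _ => ?_
        rw [show d + 1 + (e + 1) = d + 1 + 1 + e by ring]
        ring
      rw [e1, pow_zero, add_zero]
      linear_combination X * ih (d + 1) (by omega) - hi d (by omega)
  refine mul_left_cancel₀ hX ?_
  have e0 : ∑ e ∈ Finset.range (d + 1), X ^ ((d - e) + (e - d)) * x e =
      ∑ e ∈ Finset.range (d + 1), X ^ (d - e) * x e := by
    refine Finset.sum_congr rfl fun e he => ?_
    rw [Nat.sub_eq_zero_of_le (by simpa [Nat.lt_succ_iff] using he : e ≤ d), add_zero]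
  rcases hd.eq_or_lt with rfl | hd
  · obtain ⟨d, rfl⟩ := Nat.exists_eq_add_of_le' hℓ
    rw [e0, Finset.sum_range_succ]
    have e1 : ∑ e ∈ Finset.range (d + 1), X ^ (d + 1 - e) * x e =
        X * ∑ e ∈ Finset.range (d + 1), X ^ (d - e) * x e := by
      rw [Finset.mul_sum]
      refine Finset.sum_congr rfl fun e he => ?_
      rw [Nat.succ_sub (by simpa [Nat.lt_succ_iff] using he), pow_succ']
      ring
    rw [e1, Nat.sub_self]
    rw [Nat.add_sub_cancel] at hr
    linear_combination X * left d (by omega) - hr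
  · obtain ⟨m, rfl⟩ := Nat.exists_eq_add_of_lt hd
    rw [show d + m + 1 + 1 = d + 1 + (m + 1) by ring, Finset.sum_range_add, e0]
    have e1 : ∑ j ∈ Finset.range (m + 1), X ^ ((d - (d + 1 + j)) + (d + 1 + j - d)) *
        x (d + 1 + j) = X * ∑ j ∈ Finset.range (m + 1), X ^ j * x (d + 1 + j) := by
      rw [Finset.mul_sum]
      refine Finset.sum_congr rfl fun j _ => ?_
      rw [show d - (d + 1 + j) + (d + 1 + j - d) = j + 1 by omega]
      ring
    rw [e1]
    linear_combination left d hd + X * right m d (by omega)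

include h0 hq in
theorem foldedSeq_walk {ℓ d : ℕ} (hℓ : 1 ≤ ℓ) (hd : d ≤ ℓ) (M : ℕ) :
    ∑ e ∈ Finset.range (ℓ + 1), (q ^ (M + 1)) ^ ((d - e) + (e - d)) * foldedSeq q ℓ e M =
      (1 - q ^ (M + 1)) * foldedSeq q ℓ d (M + 1) := by
  -- q^(M+1) = -1 would give q^(2M+2) = 1.
  have hX : 1 + q ^ (M + 1) ≠ 0 := by
    intro h
    refine hq (2 * M + 1) ?_
    rw [show 2 * M + 1 + 1 = (M + 1) + (M + 1) by ring, pow_add]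
    linear_combination (q ^ (M + 1) - 1) * h
  refine tridiagonal_solution (y := fun d => foldedSeq q ℓ d (M + 1)) hX hℓ
    (foldedSeq_edge h0 hq hℓ M) ?_ (fun d h => foldedSeq_interior h0 hq h M) hd
  simp only [foldedSeq_sub hℓ]
  rw [← foldedSeq_sub le_rfl, Nat.sub_self]
  exact foldedSeq_edge h0 hq hℓ M

theorem multisumSeq_zero (ℓ b : ℕ) : multisumSeq q ℓ b 0 = 1 := by
  have h1 : ∀ φ : ℕ → K, triOp q φ 0 = φ 0 := fun φ => by
    simp [triOp, convOp_apply, triWeight, qFac]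
  have h2 : ∀ φ : ℕ → K, pairOp q φ 0 = φ 0 := fun φ => by
    simp [pairOp, Module.End.mul_apply, h1, powOp_apply]
  have h3 : ∀ (m : ℕ) (φ : ℕ → K), (triOp q ^ m) φ 0 = φ 0 := fun m => by
    induction m with
    | zero => simp
    | succ m ih => intro φ; rw [pow_succ, Module.End.mul_apply, ih, h1]
  have h4 : ∀ (m : ℕ) (φ : ℕ → K), (pairOp q ^ m) φ 0 = φ 0 := fun m => by
    induction m with
    | zero => simp
    | succ m ih => intro φ; rw [pow_succ, Module.End.mul_apply, ih, h2]
  rw [multisumSeq, Module.End.mul_apply, h4, h3]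
  simp [invFac, qFac]

end MultisumSequences

/-! ### Tight pairs of partitions -/

/-- Insert `k` entries equal to `m` in front of a finitely supported sequence. -/
noncomputable def prepend (k m : ℕ) (u : ℕ →₀ ℕ) : ℕ →₀ ℕ :=
  Finsupp.onFinset (Finset.range k ∪ u.support.map (addRightEmbedding k))
    (fun j => if j < k then m else u (j - k)) (by
      intro j hj
      split_ifs at hj with h
      · simp [h]
      · simp only [Finset.mem_union, Finset.mem_map, addRightEmbedding_apply]
        exact Or.inr ⟨j - k, Finsupp.mem_support_iff.2 hj, by omega⟩)

theorem prepend_apply (k m : ℕ) (u : ℕ →₀ ℕ) (j : ℕ) :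
    prepend k m u j = if j < k then m else u (j - k) := rfl

@[simp] theorem prepend_zero (m : ℕ) (u : ℕ →₀ ℕ) : prepend 0 m u = u := by
  ext j
  simp [prepend_apply]

/-- The sum of the entries. -/
def entrySum (u : ℕ →₀ ℕ) : ℕ := u.sum fun _ a => a

theorem entrySum_prepend (k m : ℕ) (u : ℕ →₀ ℕ) :
    entrySum (prepend k m u) = k * m + entrySum u := by
  obtain ⟨n, hn⟩ := u.support.exists_nat_subset_range
  have h2 : (prepend k m u).support ⊆ Finset.range (k + n) := by
    intro j hj
    rw [Finsupp.mem_support_iff, prepend_apply] at hj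
    rw [Finset.mem_range]
    split_ifs at hj with h
    · omega
    · have := hn (Finsupp.mem_support_iff.2 hj)
      rw [Finset.mem_range] at this
      omega
  rw [entrySum, entrySum, Finsupp.sum_of_support_subset _ h2 _ (fun _ _ => rfl),
    Finsupp.sum_of_support_subset _ hn _ (fun _ _ => rfl), Finset.sum_range_add]
  congr 1
  · rw [Finset.sum_congr rfl fun j hj => by
      rw [prepend_apply, if_pos (Finset.mem_range.1 hj)]]
    simp
  · exact Finset.sum_congr rfl fun j _ => by
      rw [prepend_apply, if_neg (by omega), Nat.add_sub_cancel_left]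

theorem prepend_injective {k k' m : ℕ} {u u' : ℕ →₀ ℕ} (hu : ∀ j, u j < m) (hu' : ∀ j, u' j < m)
    (h : prepend k m u = prepend k' m u') : k = k' ∧ u = u' := by
  have hk : ∀ {k k' : ℕ} {u u' : ℕ →₀ ℕ}, (∀ j, u j < m) →
      prepend k m u = prepend k' m u' → k' ≤ k := by
    intro k k' u u' hu h
    by_contra! hlt
    have := DFunLike.congr_fun h k
    rw [prepend_apply, prepend_apply, if_neg (lt_irrefl _), if_pos hlt] at this
    exact (hu _).ne this
  have e := le_antisymm (hk hu' h.symm) (hk hu h)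
  subst e
  refine ⟨rfl, Finsupp.ext fun j => ?_⟩
  simpa [prepend_apply] using DFunLike.congr_fun h (j + k)

/-- The pair `(u, v)` is a tight cylindric partition of profile `(c₁, c₂)` with parts at
most `M`. -/
structure IsTightPair (c₁ c₂ M : ℕ) (u v : ℕ →₀ ℕ) : Prop where
  anti_left : Antitone u
  anti_right : Antitone v
  right_le : ∀ j, v (j + c₂) ≤ u j
  left_le : ∀ j, u (j + c₁) ≤ v j
  tight : ∀ m, 0 < m → (∀ k, u k ≠ m) ∨ ∀ k, v k ≠ m
  left_bound : u 0 ≤ M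
  right_bound : v 0 ≤ M

namespace IsTightPair

variable {c₁ c₂ M k : ℕ} {u v : ℕ →₀ ℕ}

theorem swap (h : IsTightPair c₁ c₂ M u v) : IsTightPair c₂ c₁ M v u :=
  ⟨h.anti_right, h.anti_left, h.left_le, h.right_le, fun m hm => (h.tight m hm).symm,
    h.right_bound, h.left_bound⟩

theorem left_lt (h : IsTightPair c₁ c₂ M u v) (j : ℕ) : u j < M + 1 :=
  Nat.lt_succ_of_le ((h.anti_left (Nat.zero_le j)).trans h.left_bound)

theorem right_lt (h : IsTightPair c₁ c₂ M u v) (j : ℕ) : v j < M + 1 := h.swap.left_lt j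

/-- Prepending k entries shifts the indices of one row by k, which is absorbed by the profile.
Tightness at M + 1 holds because the other row stays at most M. -/
theorem prepend_left (h : IsTightPair (c₁ - k) (c₂ + k) M u v) (hk : k ≤ c₁) :
    IsTightPair c₁ c₂ (M + 1) (prepend k (M + 1) u) v where
  anti_left i j hij := by
    simp only [prepend_apply]
    split_ifs with h1 h2 h2
    · exact le_rfl
    · omega
    · exact (h.left_lt _).le
    · exact h.anti_left (by omega)
  anti_right := h.anti_right
  right_le j := by
    rw [prepend_apply]
    split_ifs with h1
    · exact (h.right_lt _).le
    · have := h.right_le (j - k)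
      rwa [show j - k + (c₂ + k) = j + c₂ by omega] at this
  left_le j := by
    rw [prepend_apply, if_neg (by omega), show j + c₁ - k = j + (c₁ - k) by omega]
    exact h.left_le j
  tight m hm := by
    by_cases hM : m = M + 1
    · exact Or.inr fun j => hM ▸ (h.right_lt j).ne
    · refine (h.tight m hm).imp_left fun hu j => ?_
      rw [prepend_apply]
      split_ifs
      · exact Ne.symm hM
      · exact hu _
  left_bound := by
    rw [prepend_apply]
    split_ifs
    · exact le_rfl
    · exact (h.left_lt _).le
  right_bound := h.right_bound.trans (Nat.le_succ M)

/-- Here k is the number of entries M + 1 in u; it is at most c₁ because u c₁ ≤ v 0 ≤ M. -/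
theorem exists_eq_prepend_left (h : IsTightPair c₁ c₂ (M + 1) u v) (hv : v 0 ≤ M) :
    ∃ k ≤ c₁, ∃ u', u = prepend k (M + 1) u' ∧ IsTightPair (c₁ - k) (c₂ + k) M u' v := by
  have hc : u c₁ ≠ M + 1 := by
    have := h.left_le 0
    rw [zero_add] at this
    omega
  classical
  have hex : ∃ j, u j ≠ M + 1 := ⟨c₁, hc⟩
  obtain ⟨k, hk⟩ : ∃ k, k = Nat.find hex := ⟨_, rfl⟩
  have hkc : k ≤ c₁ := hk ▸ Nat.find_min' hex hc
  have hku : u k ≠ M + 1 := hk ▸ Nat.find_spec hex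
  have hlt : ∀ j < k, u j = M + 1 := fun j hj => not_not.1 (Nat.find_min hex (hk ▸ hj))
  have happ : ∀ j, u.comapDomain (· + k) ((add_left_injective k).injOn) j = u (j + k) :=
    fun j => rfl
  refine ⟨k, hkc, u.comapDomain (· + k) ((add_left_injective k).injOn), ?_, ?_⟩
  · ext j
    rw [prepend_apply]
    split_ifs with hj
    · exact hlt j hj
    · rw [happ, Nat.sub_add_cancel (by omega)]
  · refine ⟨fun i j hij => ?_, h.anti_right, fun j => ?_, fun j => ?_, fun m hm => ?_, ?_, hv⟩
    · rw [happ, happ]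
      exact h.anti_left (by omega)
    · rw [happ, show j + (c₂ + k) = j + k + c₂ by ring]
      exact h.right_le _
    · rw [happ, show j + (c₁ - k) + k = j + c₁ by omega]
      exact h.left_le j
    · exact (h.tight m hm).imp_left fun hu j => hu _
    · rw [happ, zero_add]
      have := h.anti_left (Nat.zero_le k)
      have := h.left_bound
      omega

theorem eq_zero (h : IsTightPair c₁ c₂ 0 u v) : u = 0 ∧ v = 0 :=
  ⟨Finsupp.ext fun j => Nat.lt_one_iff.1 (h.left_lt j),
    Finsupp.ext fun j => Nat.lt_one_iff.1 (h.right_lt j)⟩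

theorem zero : IsTightPair c₁ c₂ M 0 0 :=
  ⟨fun _ _ _ => le_rfl, fun _ _ _ => le_rfl, fun _ => le_rfl, fun _ => le_rfl,
    fun _ hm => Or.inl fun _ => hm.ne, Nat.zero_le _, Nat.zero_le _⟩

end IsTightPair

/-- Change the profile from `(e, ℓ - e)` to `(d, ℓ - d)` by inserting copies of `m`. -/
noncomputable def extendPair (d m : ℕ) (x : Σ _ : ℕ, (ℕ →₀ ℕ) × (ℕ →₀ ℕ)) :
    (ℕ →₀ ℕ) × (ℕ →₀ ℕ) :=
  (prepend (d - x.1) m x.2.1, prepend (x.1 - d) m x.2.2)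

open Classical in
/-- The tight cylindric partitions of profile `(d, ℓ - d)` with parts at most `M`. -/
noncomputable def tightPairs (ℓ : ℕ) : ℕ → ℕ → Finset ((ℕ →₀ ℕ) × (ℕ →₀ ℕ))
  | 0, _ => {(0, 0)}
  | M + 1, d => ((Finset.range (ℓ + 1)).sigma fun e => tightPairs ℓ M e).image
      (extendPair d (M + 1))

theorem mem_tightPairs {ℓ M d : ℕ} (hd : d ≤ ℓ) (p : (ℕ →₀ ℕ) × (ℕ →₀ ℕ)) :
    p ∈ tightPairs ℓ M d ↔ IsTightPair d (ℓ - d) M p.1 p.2 := by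
  induction M generalizing d p with
  | zero =>
    rw [tightPairs, Finset.mem_singleton]
    constructor
    · rintro rfl
      exact IsTightPair.zero
    · intro h
      exact Prod.ext h.eq_zero.1 h.eq_zero.2
  | succ M ih =>
    rw [tightPairs, Finset.mem_image]
    constructor
    · rintro ⟨⟨e, u, v⟩, hx, rfl⟩
      rw [Finset.mem_sigma, Finset.mem_range] at hx
      have he : e ≤ ℓ := Nat.lt_succ_iff.1 hx.1
      have h := (ih he _).1 hx.2
      simp only [extendPair] at h ⊢
      rcases le_total e d with hed | hed
      · rw [Nat.sub_eq_zero_of_le hed, prepend_zero]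
        refine IsTightPair.prepend_left ?_ (Nat.sub_le _ _)
        rwa [show d - (d - e) = e by omega, show ℓ - d + (d - e) = ℓ - e by omega]
      · rw [Nat.sub_eq_zero_of_le hed, prepend_zero]
        refine (IsTightPair.prepend_left ?_ (by omega)).swap
        rw [show d + (e - d) = e by omega, show ℓ - d - (e - d) = ℓ - e by omega]
        exact h.swap
    · intro h
      obtain ⟨u, v⟩ := p
      have hM : v 0 ≤ M ∨ u 0 ≤ M := by
        have h1 := h.left_bound
        have h2 := h.right_bound
        have h3 := (h.tight (M + 1) (Nat.succ_pos M)).imp (fun h => h 0) fun h => h 0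
        simp only at h1 h2 h3
        omega
      rcases hM with hM | hM
      · obtain ⟨k, hk, u', hu, hu'⟩ := h.exists_eq_prepend_left hM
        simp only at hu hu'
        refine ⟨⟨d - k, u', v⟩, ?_, ?_⟩
        · rw [Finset.mem_sigma, Finset.mem_range]
          refine ⟨by dsimp only; omega, (ih (by dsimp only; omega) _).2 ?_⟩
          rwa [show ℓ - (d - k) = ℓ - d + k by omega]
        · simp only [extendPair]
          rw [show d - (d - k) = k by omega, show d - k - d = 0 by omega, prepend_zero, hu]
      · obtain ⟨k, hk, v', hv, hv'⟩ := h.swap.exists_eq_prepend_left hM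
        simp only at hv hv'
        refine ⟨⟨d + k, u, v'⟩, ?_, ?_⟩
        · rw [Finset.mem_sigma, Finset.mem_range]
          refine ⟨by dsimp only; omega, (ih (by dsimp only; omega) _).2 ?_⟩
          rw [show ℓ - (d + k) = ℓ - d - k by omega]
          exact hv'.swap
        · simp only [extendPair]
          rw [show d - (d + k) = 0 by omega, show d + k - d = k by omega, prepend_zero, hv]

/-! ### The generating function of walks -/

/-- The generating function of walks with `M` steps on `{0, …, ℓ}` starting at `d`. -/
noncomputable def walkGF (ℓ : ℕ) : ℕ → ℕ → PowerSeries ℤ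
  | 0, _ => 1
  | M + 1, d => ∑ e ∈ Finset.range (ℓ + 1),
      (PowerSeries.X ^ (M + 1)) ^ ((d - e) + (e - d)) * walkGF ℓ M e

theorem sum_tightPairs {ℓ d : ℕ} (M : ℕ) (hd : d ≤ ℓ) :
    ∑ p ∈ tightPairs ℓ M d, (PowerSeries.X : PowerSeries ℤ) ^ (entrySum p.1 + entrySum p.2) =
      walkGF ℓ M d := by
  induction M generalizing d with
  | zero => simp [tightPairs, walkGF, entrySum]
  | succ M ih =>
    rw [tightPairs, walkGF, Finset.sum_image, Finset.sum_sigma]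
    · refine Finset.sum_congr rfl fun e he => ?_
      rw [← ih (by simpa [Nat.lt_succ_iff] using he), Finset.mul_sum]
      refine Finset.sum_congr rfl fun p _ => ?_
      rw [extendPair, entrySum_prepend, entrySum_prepend, ← pow_mul, ← pow_add]
      congr 1
      ring
    · rintro ⟨e, u, v⟩ hx ⟨e', u', v'⟩ hx' h
      simp only [Finset.coe_sigma, Set.mem_sigma_iff, Finset.coe_range, Set.mem_Iio,
        Finset.mem_coe] at hx hx'
      have h1 := (mem_tightPairs (by omega) _).1 hx.2
      have h2 := (mem_tightPairs (by omega) _).1 hx'.2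
      simp only [extendPair, Prod.mk.injEq] at h
      obtain ⟨e1, rfl⟩ := prepend_injective h1.left_lt h2.left_lt h.1
      obtain ⟨e2, rfl⟩ := prepend_injective h1.right_lt h2.right_lt h.2
      -- The truncated differences d - e and e - d together determine e.
      obtain rfl : e = e' := by omega
      rfl

/-- A sum converges if each coefficient of `z ^ M` only involves finitely many terms. -/
theorem hasSum_of_coeff_finset {ι : Type*} {f : ι → ZQ} {F : ZQ} (s : ℕ → Finset ι)
    (h0 : ∀ M, ∀ i ∉ s M, PowerSeries.coeff M (f i) = 0)
    (h : ∀ M, ∑ i ∈ s M, PowerSeries.coeff M (f i) = PowerSeries.coeff M F) : HasSum f F := by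
  rw [PowerSeries.WithPiTopology.hasSum_iff_hasSum_coeff]
  intro M
  rw [← h M]
  exact hasSum_sum_of_ne_finset_zero (h0 M)

/-- The series `(1 - z) ∑ g(M) z ^ M`. -/
noncomputable def oneSubMulMk (g : ℕ → PowerSeries ℤ) : ZQ := (1 - z) * PowerSeries.mk g

theorem coeff_zero_oneSubMulMk (g : ℕ → PowerSeries ℤ) :
    PowerSeries.coeff 0 (oneSubMulMk g) = g 0 := by
  simp [oneSubMulMk, z, sub_mul]

theorem coeff_succ_oneSubMulMk (g : ℕ → PowerSeries ℤ) (M : ℕ) :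
    PowerSeries.coeff (M + 1) (oneSubMulMk g) = g (M + 1) - g M := by
  simp [oneSubMulMk, z, sub_mul, PowerSeries.coeff_succ_X_mul]

theorem q_pow (n : ℕ) : q ^ n = PowerSeries.C (PowerSeries.X ^ n) := by
  rw [q, map_pow]

/-! ### The series of tight cylindric partitions -/

theorem coeff_tightTerm {c : Fin 2 → ℕ} (π : Tight c) (M : ℕ) :
    PowerSeries.coeff M (tightTerm c π) =
      if M = max (π.1.row 0 0) (π.1.row 1 0) then
        PowerSeries.X ^ (entrySum (π.1.row 0) + entrySum (π.1.row 1)) else 0 := by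
  have h1 : π.1.largestPart = max (π.1.row 0 0) (π.1.row 1 0) := by
    simp [CylindricPartition.largestPart, Fin.univ_succ]
  have h2 : π.1.weight = entrySum (π.1.row 0) + entrySum (π.1.row 1) := by
    simp [CylindricPartition.weight, Fin.sum_univ_two, entrySum]
  rw [tightTerm, h1, h2, q_pow, PowerSeries.coeff_mul_C, z, PowerSeries.coeff_X_pow]
  split_ifs <;> simp

theorem isTightPair_rows {c₁ c₂ : ℕ} (π : Tight ![c₁, c₂]) {M : ℕ}
    (h : max (π.1.row 0 0) (π.1.row 1 0) ≤ M) :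
    IsTightPair c₁ c₂ M (π.1.row 0) (π.1.row 1) where
  anti_left := π.1.antitone_row 0
  anti_right := π.1.antitone_row 1
  right_le := π.1.interlacing 0
  left_le := π.1.interlacing 1
  tight m hm := by
    obtain ⟨i, hi⟩ := π.2 m hm
    fin_cases i
    · exact Or.inl hi
    · exact Or.inr hi
  left_bound := (le_max_left _ _).trans h
  right_bound := (le_max_right _ _).trans h

theorem IsTightPair.exists_tight {c₁ c₂ M : ℕ} {u v : ℕ →₀ ℕ} (h : IsTightPair c₁ c₂ M u v) :
    ∃ π : Tight ![c₁, c₂], (π.1.row 0, π.1.row 1) = (u, v) := by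
  refine ⟨⟨⟨![u, v], ?_, ?_⟩, ?_⟩, rfl⟩
  · intro i
    fin_cases i
    · exact h.anti_left
    · exact h.anti_right
  · intro i
    fin_cases i
    · exact h.right_le
    · exact h.left_le
  · intro m hm
    rcases h.tight m hm with h | h
    · exact ⟨0, h⟩
    · exact ⟨1, h⟩

theorem rows_injective (c : Fin 2 → ℕ) :
    Function.Injective fun π : Tight c => (π.1.row 0, π.1.row 1) := by
  intro π π' h
  simp only [Prod.mk.injEq] at h
  refine Subtype.ext (CylindricPartition.ext (funext fun i => ?_))
  fin_cases i
  · exact h.1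
  · exact h.2

/-- The factor 1 - z turns the count with parts at most M into the count with largest part exactly
M. -/
theorem hasSum_tightTerm (c₁ c₂ : ℕ) :
    HasSum (tightTerm ![c₁, c₂]) (oneSubMulMk fun M => walkGF (c₁ + c₂) M c₁) := by
  have hmem : ∀ M p, p ∈ tightPairs (c₁ + c₂) M c₁ ↔ IsTightPair c₁ c₂ M p.1 p.2 := by
    intro M p
    rw [mem_tightPairs (Nat.le_add_right _ _), Nat.add_sub_cancel_left]
  refine hasSum_of_coeff_finset
    (fun M => (tightPairs (c₁ + c₂) M c₁).preimage _ (rows_injective _).injOn) ?_ ?_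
  · intro M π hπ
    rw [coeff_tightTerm, if_neg]
    intro h
    refine hπ (Finset.mem_preimage.2 ((hmem M _).2 (isTightPair_rows π h.ge)))
  · intro M
    simp only [coeff_tightTerm]
    rw [Finset.sum_preimage _ _ (rows_injective _).injOn
      (fun p => if M = max (p.1 0) (p.2 0) then
        (PowerSeries.X : PowerSeries ℤ) ^ (entrySum p.1 + entrySum p.2) else 0)]
    · cases M with
      | zero => simp [tightPairs, coeff_zero_oneSubMulMk, walkGF, entrySum]
      | succ M =>
        rw [coeff_succ_oneSubMulMk, ← sum_tightPairs _ (Nat.le_add_right _ _),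
          ← sum_tightPairs _ (Nat.le_add_right _ _)]
        have hf : tightPairs (c₁ + c₂) M c₁ =
            (tightPairs (c₁ + c₂) (M + 1) c₁).filter fun p => max (p.1 0) (p.2 0) ≤ M := by
          ext p
          rw [Finset.mem_filter, hmem, hmem]
          constructor
          · intro h
            exact ⟨{ h with
              left_bound := h.left_bound.trans (Nat.le_succ M)
              right_bound := h.right_bound.trans (Nat.le_succ M) },
              max_le h.left_bound h.right_bound⟩
          · rintro ⟨h, h'⟩
            exact { h with
              left_bound := (le_max_left _ _).trans h'
              right_bound := (le_max_right _ _).trans h' }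
        rw [hf, Finset.sum_filter, ← Finset.sum_sub_distrib]
        refine Finset.sum_congr rfl fun p hp => ?_
        have h := (hmem _ _).1 hp
        have : max (p.1 0) (p.2 0) ≤ M + 1 := max_le h.left_bound h.right_bound
        split_ifs <;> first | omega | simp
    · intro p hp hp'
      exact absurd ((hmem _ _).1 hp).exists_tight fun ⟨π, h⟩ => hp' ⟨π, h⟩

/-! ### Iterated convolutions as sums over chains -/

section ChainSums

variable {K : Type*} [Field K]

/-- `1 / (q)_m`, and `0` for negative `m`. -/
def invFacInt (q : K) (m : ℤ) : K := if 0 ≤ m then (qFac q m.toNat)⁻¹ else 0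

theorem invFacInt_natCast (q : K) (n : ℕ) : invFacInt q n = (qFac q n)⁻¹ := by
  simp [invFacInt]

theorem invFacInt_sub_of_le (q : K) {M N : ℕ} (h : N ≤ M) :
    invFacInt q ((M : ℤ) - N) = (qFac q (M - N))⁻¹ := by
  rw [← Nat.cast_sub h, invFacInt_natCast]

theorem invFacInt_sub_of_lt (q : K) {M N : ℕ} (h : M < N) : invFacInt q ((M : ℤ) - N) = 0 :=
  if_neg (by omega)

/-- Iterated convolution with the weights `w 0, …, w (ℓ - 1)`. -/
def chainSum (q : K) : (ℕ → ℕ → K) → ℕ → ℕ → K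
  | _, 0 => invFac q
  | w, ℓ + 1 => convOp q (w 0) (chainSum q (fun i => w (i + 1)) ℓ)

/-- The summand of `chainSum` at the chain `M ≥ N_1 ≥ ⋯ ≥ N_ℓ`. -/
def chainTerm (q : K) : (ℕ → ℕ → K) → (ℓ : ℕ) → ℕ → (Fin ℓ → ℕ) → K
  | _, 0, M, _ => invFac q M
  | w, ℓ + 1, M, N => w 0 (N 0) * invFacInt q ((M : ℤ) - (N 0 : ℤ)) *
      chainTerm q (fun i => w (i + 1)) ℓ (N 0) (Fin.tail N)

theorem sum_piFinset_cons {R : Type*} [AddCommMonoid R] {ℓ : ℕ} (s : Finset ℕ)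
    (f : (Fin (ℓ + 1) → ℕ) → R) :
    ∑ N ∈ Fintype.piFinset (fun _ : Fin (ℓ + 1) => s), f N =
      ∑ a ∈ s, ∑ t ∈ Fintype.piFinset (fun _ : Fin ℓ => s), f (Fin.cons a t) := by
  rw [← Finset.sum_product']
  refine Finset.sum_bij' (fun N _ => (N 0, Fin.tail N)) (fun x _ => Fin.cons x.1 x.2)
    ?_ ?_ ?_ ?_ ?_
  · intro N hN
    rw [Fintype.mem_piFinset] at hN
    exact Finset.mem_product.2 ⟨hN 0, Fintype.mem_piFinset.2 fun i => hN i.succ⟩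
  · intro x hx
    rw [Finset.mem_product, Fintype.mem_piFinset] at hx
    exact Fintype.mem_piFinset.2 fun i => Fin.cases hx.1 hx.2 i
  · intro N _
    exact Fin.cons_self_tail N
  · intro x _
    simp
  · intro N _
    rw [Fin.cons_self_tail]

theorem sum_chainTerm (q : K) (w : ℕ → ℕ → K) (ℓ : ℕ) {M R : ℕ} (h : M < R) :
    ∑ N ∈ Fintype.piFinset (fun _ : Fin ℓ => Finset.range R), chainTerm q w ℓ M N =
      chainSum q w ℓ M := by
  induction ℓ generalizing w M with
  | zero => simp [chainTerm, chainSum]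
  | succ ℓ ih =>
    rw [sum_piFinset_cons, chainSum, convOp_apply]
    symm
    refine Finset.sum_subset_zero_on_sdiff (Finset.range_mono h) ?_ ?_
    · intro a ha
      rw [Finset.mem_sdiff, Finset.mem_range, Finset.mem_range] at ha
      refine Finset.sum_eq_zero fun t _ => ?_
      rw [chainTerm, Fin.cons_zero, invFacInt_sub_of_lt _ (by omega), mul_zero, zero_mul]
    · intro a ha
      have ha' : a ≤ M := by simpa [Nat.lt_succ_iff] using ha
      rw [← ih (fun i => w (i + 1)) (ha'.trans_lt h), Finset.mul_sum, Finset.sum_div]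
      refine Finset.sum_congr rfl fun t _ => ?_
      rw [chainTerm, Fin.cons_zero, Fin.tail_cons, invFacInt_sub_of_le _ ha']
      ring

theorem chainTerm_eq_zero (q : K) (w : ℕ → ℕ → K) {ℓ M : ℕ} {N : Fin ℓ → ℕ}
    (h : N ∉ Fintype.piFinset fun _ : Fin ℓ => Finset.range (M + 1)) :
    chainTerm q w ℓ M N = 0 := by
  contrapose! h
  rw [Fintype.mem_piFinset]
  induction ℓ generalizing w M with
  | zero => exact fun i => i.elim0
  | succ ℓ ih =>
    rw [chainTerm] at h
    have h0 : N 0 ≤ M := by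
      by_contra! hlt
      exact h (by rw [invFacInt_sub_of_lt _ hlt, mul_zero, zero_mul])
    intro i
    refine Fin.cases (Finset.mem_range.2 (Nat.lt_succ_of_le h0)) (fun i => ?_) i
    have := ih _ (right_ne_zero_of_mul h) i
    rw [Finset.mem_range] at this ⊢
    exact this.trans_le (Nat.succ_le_succ h0)

theorem coord_one {ℓ : ℕ} (N : Fin (ℓ + 1) → ℕ) : coord N 1 = N 0 := by
  simp [coord]

theorem coord_tail {ℓ : ℕ} (N : Fin (ℓ + 1) → ℕ) (i : ℕ) :
    coord (Fin.tail N) (i + 1) = coord N (i + 2) := by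
  unfold coord
  by_cases h : i + 1 ≤ ℓ
  · rw [dif_pos ⟨by omega, h⟩, dif_pos ⟨by omega, by omega⟩]
    rfl
  · rw [dif_neg (by omega), dif_neg (by omega)]

theorem chainTerm_succ (q : K) (w : ℕ → ℕ → K) (ℓ M : ℕ) (N : Fin (ℓ + 1) → ℕ) :
    chainTerm q w (ℓ + 1) M N =
      invFacInt q ((M : ℤ) - (coord N 1 : ℤ)) *
        ((∏ i ∈ Finset.range (ℓ + 1), w i (coord N (i + 1))) *
        ((∏ i ∈ Finset.range ℓ, invFacInt q ((coord N (i + 1) : ℤ) - (coord N (i + 2) : ℤ))) *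
          invFac q (coord N (ℓ + 1)))) := by
  induction ℓ generalizing w M with
  | zero =>
    simp only [chainTerm, coord_one, Finset.prod_range_one, Finset.prod_range_zero, zero_add]
    ring
  | succ ℓ ih =>
    have h1 : coord (Fin.tail N) 1 = coord N 2 := coord_tail N 0
    have h2 : ∀ i, coord (Fin.tail N) (i + 2) = coord N (i + 3) := fun i => coord_tail N (i + 1)
    rw [chainTerm, ih, ← coord_one N, Finset.prod_range_succ' _ (ℓ + 1),
      Finset.prod_range_succ' (fun i => invFacInt q ((coord N (i + 1) : ℤ) - _)) ℓ]
    simp only [h1, h2, coord_tail, zero_add, add_assoc, Nat.reduceAdd]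
    ring

/-- The weights of the multisum with parameter `b`. -/
def multisumWeight (q : K) (b i N : ℕ) : K :=
  triWeight q N * if i % 2 = 1 ∧ i < 2 * b then q⁻¹ ^ N else 1

/-- Weights are indexed from 0, so the factor q⁻¹ ^ N at odd i belongs to the even-indexed N_{i+1}.
The first two convolutions form one `pairOp`, and shifting the weights by two lowers b by one. -/
theorem chainSum_multisumWeight (q : K) {ℓ b : ℕ} (h : 2 * b ≤ ℓ) :
    chainSum q (multisumWeight q b) ℓ = multisumSeq q ℓ b := by
  induction b generalizing ℓ with
  | zero =>
    have e : multisumWeight q 0 = fun _ => triWeight q := by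
      funext i N
      simp [multisumWeight]
    rw [e, multisumSeq, pow_zero, one_mul, mul_zero, Nat.sub_zero]
    clear h e
    induction ℓ with
    | zero => rfl
    | succ ℓ ih =>
      rw [chainSum, ih, pow_succ']
      rfl
  | succ b ih =>
    obtain ⟨ℓ, rfl⟩ := Nat.exists_eq_add_of_le' (show 2 ≤ ℓ by omega)
    have e0 : multisumWeight q (b + 1) 0 = triWeight q := by
      funext N
      simp [multisumWeight]
    have e1 : convOp q (multisumWeight q (b + 1) (0 + 1)) = triOp q * powOp q⁻¹ := by
      refine LinearMap.ext fun φ => funext fun M => ?_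
      rw [Module.End.mul_apply, triOp, convOp_apply, convOp_apply]
      refine Finset.sum_congr rfl fun N _ => ?_
      rw [multisumWeight, if_pos (by omega), powOp_apply, mul_assoc (triWeight q N)]
    have e2 : (fun i => multisumWeight q (b + 1) (i + 1 + 1)) = multisumWeight q b := by
      funext i N
      have : (i + 1 + 1) % 2 = 1 ∧ i + 1 + 1 < 2 * (b + 1) ↔ i % 2 = 1 ∧ i < 2 * b := by omega
      simp only [multisumWeight, this]
    rw [chainSum, chainSum, e0, e1, e2, ih (by omega), multisumSeq, multisumSeq, pow_succ', pairOp,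
      show ℓ + 2 - 2 * (b + 1) = ℓ - 2 * b by omega]
    rfl

theorem prod_Icc_one_eq_prod_range {R : Type*} [CommMonoid R] (f : ℕ → R) (n : ℕ) :
    ∏ i ∈ Finset.Icc 1 n, f i = ∏ i ∈ Finset.range n, f (i + 1) := by
  induction n with
  | zero => simp
  | succ n ih => rw [Finset.prod_Icc_succ_top (by omega), Finset.prod_range_succ, ih]

theorem prod_multisumWeight {q : K} (h0 : q ≠ 0) {ℓ b : ℕ} (hb : b ≤ ℓ / 2) (f : ℕ → ℕ) :
    ∏ i ∈ Finset.range ℓ, multisumWeight q b i (f (i + 1)) =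
      q ^ ((∑ i ∈ Finset.Icc 1 ℓ, (f i + 1).choose 2) - ∑ i ∈ Finset.Icc 1 b, f (2 * i)) := by
  have e1 : ∏ i ∈ Finset.range ℓ, triWeight q (f (i + 1)) =
      q ^ ∑ i ∈ Finset.Icc 1 ℓ, (f i + 1).choose 2 := by
    rw [← Finset.prod_pow_eq_pow_sum, prod_Icc_one_eq_prod_range]
    rfl
  have e2 : ∀ b, ∏ i ∈ Finset.range (2 * b), (if i % 2 = 1 then q⁻¹ ^ f (i + 1) else 1) =
      q⁻¹ ^ ∑ i ∈ Finset.Icc 1 b, f (2 * i) := by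
    intro b
    induction b with
    | zero => simp
    | succ b ih =>
      rw [show 2 * (b + 1) = 2 * b + 1 + 1 by ring, Finset.prod_range_succ, Finset.prod_range_succ,
        ih, if_neg (by omega), if_pos (by omega), Finset.sum_Icc_succ_top (by omega), pow_add,
        mul_one]
      rfl
  have e3 : ∏ i ∈ Finset.range ℓ, (if i % 2 = 1 ∧ i < 2 * b then q⁻¹ ^ f (i + 1) else 1) =
      q⁻¹ ^ ∑ i ∈ Finset.Icc 1 b, f (2 * i) := by
    rw [← e2]
    symm
    refine Finset.prod_subset_one_on_sdiff (Finset.range_mono (by omega)) ?_ ?_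
    · intro i hi
      rw [Finset.mem_sdiff, Finset.mem_range, Finset.mem_range] at hi
      rw [if_neg (by omega)]
    · intro i hi
      rw [Finset.mem_range] at hi
      simp [hi]
  unfold multisumWeight
  rw [Finset.prod_mul_distrib, e1, e3, pow_sub₀ _ h0 (sum_even_le_sum_choose b f hb), inv_pow]

end ChainSums

/-! ### Passage to the field of fractions of `ℤ⟦q⟧` -/

/-- `q` in the field of fractions of `ℤ⟦q⟧`. -/
noncomputable def qFrac : FractionRing (PowerSeries ℤ) :=
  algebraMap (PowerSeries ℤ) _ PowerSeries.X

theorem algebraMap_X :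
    algebraMap (PowerSeries ℤ) (FractionRing (PowerSeries ℤ)) PowerSeries.X = qFrac := rfl

theorem algebraMap_frac_injective :
    Function.Injective (algebraMap (PowerSeries ℤ) (FractionRing (PowerSeries ℤ))) :=
  IsFractionRing.injective _ _

theorem qFrac_ne_zero : qFrac ≠ 0 := by
  rw [qFrac, Ne, map_eq_zero_iff _ algebraMap_frac_injective]
  exact PowerSeries.X_ne_zero

theorem qFrac_pow_ne_one (n : ℕ) : qFrac ^ (n + 1) ≠ 1 := by
  rw [qFrac, ← map_pow, ← map_one (algebraMap (PowerSeries ℤ) (FractionRing (PowerSeries ℤ)))]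
  intro h
  have := congrArg PowerSeries.constantCoeff (algebraMap_frac_injective h)
  simp at this

/-- The bridge between the two sides: both satisfy the same recursion in M, with value 1 at M = 0.
-/
theorem algebraMap_walkGF {ℓ d : ℕ} (hℓ : 1 ≤ ℓ) (hd : d ≤ ℓ) (M : ℕ) :
    algebraMap _ (FractionRing (PowerSeries ℤ)) (walkGF ℓ M d) =
      qFac qFrac M * foldedSeq qFrac ℓ d M := by
  induction M generalizing d with
  | zero => simp [walkGF, qFac, foldedSeq, multisumSeq_zero]
  | succ M ih =>
    rw [walkGF, map_sum, qFac_succ, mul_assoc,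
      ← foldedSeq_walk qFrac_ne_zero qFrac_pow_ne_one hℓ hd, Finset.mul_sum]
    refine Finset.sum_congr rfl fun e he => ?_
    rw [map_mul, ih (by simpa [Nat.lt_succ_iff] using he), map_pow, map_pow, algebraMap_X]
    ring

/-- The falling product `(1 - q ^ M) ⋯ (1 - q ^ (M - N + 1)) = (q)_M / (q)_{M - N}`. -/
noncomputable def qFalling (N M : ℕ) : PowerSeries ℤ :=
  ∏ i ∈ Finset.range N, (1 - PowerSeries.X ^ (M - i))

theorem qFalling_eq_zero {N M : ℕ} (h : M < N) : qFalling N M = 0 :=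
  -- The factor i = M is 1 - X ^ 0.
  Finset.prod_eq_zero (Finset.mem_range.2 h) (by simp)

theorem qFalling_succ_succ (N M : ℕ) :
    qFalling (N + 1) (M + 1) = (1 - PowerSeries.X ^ (M + 1)) * qFalling N M := by
  rw [qFalling, Finset.prod_range_succ', mul_comm, Nat.sub_zero, qFalling]
  simp only [Nat.add_sub_add_right]

theorem algebraMap_qFalling (N M : ℕ) :
    algebraMap _ (FractionRing (PowerSeries ℤ)) (qFalling N M) =
      qFac qFrac M * invFacInt qFrac ((M : ℤ) - N) := by
  rcases lt_or_ge M N with h | h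
  · rw [qFalling_eq_zero h, invFacInt_sub_of_lt _ h, map_zero, mul_zero]
  · rw [invFacInt_sub_of_le _ h, ← div_eq_mul_inv,
      eq_div_iff (qFac_ne_zero qFrac_pow_ne_one _)]
    induction N generalizing M with
    | zero => simp [qFalling]
    | succ N ih =>
      obtain ⟨M, rfl⟩ := Nat.exists_eq_add_of_le' (show 1 ≤ M by omega)
      rw [qFalling_succ_succ, Nat.add_sub_add_right, map_mul, mul_assoc, ih M (by omega), qFac_succ]
      simp only [map_sub, map_one, map_pow, algebraMap_X]
      ring

/-- A form of the q-binomial theorem. Passing from N to N + 1 multiplies by z(1 - q^{N+1}) / (1 -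
zq^{N+1}), and `key` reduces on coefficients to (1 - q^{M+1}) - q^{N+1}(1 - q^{M-N}) = 1 - q^{N+1}.
-/
theorem pow_mul_qPoch_eq (N : ℕ) :
    z ^ N * qPoch q N = qPoch (z * q) N * oneSubMulMk (qFalling N) := by
  induction N with
  | zero =>
    have : PowerSeries.mk (qFalling 0) = PowerSeries.mk 1 := by congr 1
    rw [oneSubMulMk, this, z, mul_comm (1 - _), PowerSeries.mk_one_mul_one_sub_eq_one]
    simp [qPoch]
  | succ N ih =>
    have key : (1 - z * q ^ (N + 1)) * PowerSeries.mk (qFalling (N + 1)) =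
        z * ((1 - q ^ (N + 1)) * PowerSeries.mk (qFalling N)) := by
      have e : (1 : ZQ) - q ^ (N + 1) = PowerSeries.C (1 - PowerSeries.X ^ (N + 1)) := by
        rw [q_pow, map_sub, map_one]
      ext1 M
      rw [e, sub_mul, one_mul, mul_assoc, q_pow, z, map_sub]
      cases M with
      | zero => simp [qFalling]
      | succ M =>
        rw [PowerSeries.coeff_succ_X_mul, PowerSeries.coeff_succ_X_mul, PowerSeries.coeff_C_mul,
          PowerSeries.coeff_C_mul, PowerSeries.coeff_mk, PowerSeries.coeff_mk, PowerSeries.coeff_mk,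
          qFalling_succ_succ, show qFalling (N + 1) M =
            qFalling N M * (1 - PowerSeries.X ^ (M - N)) from Finset.prod_range_succ _ _]
        rcases lt_or_ge M N with h | h
        · simp [qFalling_eq_zero h]
        · obtain ⟨k, rfl⟩ := Nat.exists_eq_add_of_le h
          rw [Nat.add_sub_cancel_left]
          ring
    have e1 : qPoch q (N + 1) = qPoch q N * (1 - q ^ (N + 1)) := by
      rw [qPoch, Finset.prod_range_succ, ← pow_succ']
      rfl
    have e2 : qPoch (z * q) (N + 1) = qPoch (z * q) N * (1 - z * q ^ (N + 1)) := by
      rw [qPoch, Finset.prod_range_succ, mul_assoc z, ← pow_succ']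
      rfl
    rw [oneSubMulMk] at ih ⊢
    rw [e1, e2]
    linear_combination z * (1 - q ^ (N + 1)) * ih - qPoch (z * q) N * (1 - z) * key

/-- `1 / (q)_m` in `ℤ⟦q⟧`, and `0` for negative `m`. -/
noncomputable def invFacSeries (m : ℤ) : PowerSeries ℤ :=
  if 0 ≤ m then Ring.inverse (qFac PowerSeries.X m.toNat) else 0

theorem isUnit_qFac (n : ℕ) : IsUnit (qFac (PowerSeries.X : PowerSeries ℤ) n) := by
  rw [PowerSeries.isUnit_iff_constantCoeff, map_qFac]
  simp [qFac]

theorem map_ringInverse_of_isUnit {R S : Type*} [CommRing R] [CommRing S] (f : R →+* S) {a : R}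
    (h : IsUnit a) : Ring.inverse (f a) = f (Ring.inverse a) := by
  obtain ⟨u, rfl⟩ := h
  rw [Ring.inverse_unit]
  exact Ring.inverse_unit (Units.map (f : R →* S) u)

theorem invQ_eq (m : ℤ) : invQ m = PowerSeries.C (invFacSeries m) := by
  unfold invQ invFacSeries
  split_ifs
  · rw [← map_ringInverse_of_isUnit _ (isUnit_qFac _), map_qFac]
    congr 1
    refine Finset.prod_congr rfl fun k _ => ?_
    rw [← pow_succ']
    rfl
  · rw [map_zero]

theorem algebraMap_invFacSeries (m : ℤ) :
    algebraMap _ (FractionRing (PowerSeries ℤ)) (invFacSeries m) = invFacInt qFrac m := by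
  unfold invFacSeries invFacInt
  split_ifs
  · rw [← map_ringInverse_of_isUnit _ (isUnit_qFac _), map_qFac, Ring.inverse_eq_inv']
    rfl
  · rw [map_zero]

/-! ### The `N`-form of the multisum -/

/-- Monotonicity of `s` is needed because the coefficient at M + 1 also involves the value at M. -/
theorem hasSum_oneSubMulMk {ι : Type*} {g : ι → ℕ → PowerSeries ℤ} {G : ℕ → PowerSeries ℤ}
    {s : ℕ → Finset ι} (hs : Monotone s) (h0 : ∀ M, ∀ i ∉ s M, g i M = 0)
    (h : ∀ M, ∑ i ∈ s M, g i M = G M) :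
    HasSum (fun i => oneSubMulMk (g i)) (oneSubMulMk G) := by
  refine hasSum_of_coeff_finset s ?_ ?_
  · intro M i hi
    cases M with
    | zero => rw [coeff_zero_oneSubMulMk, h0 _ _ hi]
    | succ M =>
      rw [coeff_succ_oneSubMulMk, h0 _ _ hi, h0 _ _ fun h => hi (hs (Nat.le_succ M) h), sub_zero]
  · intro M
    cases M with
    | zero => simp only [coeff_zero_oneSubMulMk, h]
    | succ M =>
      simp only [coeff_succ_oneSubMulMk, Finset.sum_sub_distrib, h]
      rw [← Finset.sum_subset (hs (Nat.le_succ M)) fun i _ hi => h0 M i hi, h]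

/-- The factor of the summand of the `N`-form that depends on `q` only, without `(q)_{N_1}`. -/
noncomputable def bigNCoeff (ℓ b : ℕ) (N : Fin ℓ → ℕ) : PowerSeries ℤ :=
  PowerSeries.X ^ ((∑ i ∈ Finset.Icc 1 ℓ, (coord N i + 1).choose 2) -
      ∑ i ∈ Finset.Icc 1 b, coord N (2 * i)) *
    ((∏ j ∈ Finset.Icc 1 (ℓ - 1), invFacSeries ((coord N j : ℤ) - (coord N (j + 1) : ℤ))) *
      invFacSeries (coord N ℓ))

theorem oneSubMulMk_mul_const (g : ℕ → PowerSeries ℤ) (a : PowerSeries ℤ) :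
    oneSubMulMk (fun M => g M * a) = oneSubMulMk g * PowerSeries.C a := by
  rw [oneSubMulMk, oneSubMulMk, mul_assoc]
  congr 1
  ext1 M
  simp

theorem bigNTerm_eq (ℓ b : ℕ) (N : Fin ℓ → ℕ) :
    bigNTerm ℓ b N = oneSubMulMk fun M => qFalling (coord N 1) M * bigNCoeff ℓ b N := by
  have h : z ^ coord N 1 * qPoch q (coord N 1) * Ring.inverse (qPoch (z * q) (coord N 1)) =
      oneSubMulMk (qFalling (coord N 1)) := by
    rw [pow_mul_qPoch_eq, mul_comm (qPoch _ _), mul_assoc,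
      Ring.mul_inverse_cancel _ (isUnit_qPoch_zq _), mul_one]
  rw [oneSubMulMk_mul_const, ← h, bigNTerm, bigNCoeff, q_pow]
  simp only [invQ_eq, map_mul, map_prod]
  ring

theorem algebraMap_qFalling_mul_bigNCoeff {ℓ b : ℕ} (hℓ : 1 ≤ ℓ) (hb : b ≤ ℓ / 2)
    (N : Fin ℓ → ℕ) (M : ℕ) :
    algebraMap _ (FractionRing (PowerSeries ℤ)) (qFalling (coord N 1) M * bigNCoeff ℓ b N) =
      qFac qFrac M * chainTerm qFrac (multisumWeight qFrac b) ℓ M N := by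
  obtain ⟨ℓ, rfl⟩ := Nat.exists_eq_add_of_le' hℓ
  rw [chainTerm_succ, prod_multisumWeight qFrac_ne_zero hb, map_mul, algebraMap_qFalling, bigNCoeff,
    Nat.add_sub_cancel, prod_Icc_one_eq_prod_range _ ℓ]
  simp only [map_mul, map_prod, map_pow, algebraMap_invFacSeries, algebraMap_X, invFacInt_natCast]
  rw [invFac]
  ring

theorem hasSum_bigNTerm {ℓ b : ℕ} (hℓ : 1 ≤ ℓ) (hb : b ≤ ℓ / 2) :
    HasSum (bigNTerm ℓ b) (oneSubMulMk fun M => walkGF ℓ M b) := by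
  rw [funext (bigNTerm_eq ℓ b)]
  refine hasSum_oneSubMulMk
    (s := fun M => Fintype.piFinset fun _ : Fin ℓ => Finset.range (M + 1)) ?_ ?_ ?_
  · intro M M' h
    exact Fintype.piFinset_subset _ _ fun _ => Finset.range_mono (Nat.succ_le_succ h)
  · intro M N hN
    apply algebraMap_frac_injective
    rw [algebraMap_qFalling_mul_bigNCoeff hℓ hb, chainTerm_eq_zero _ _ hN, mul_zero, map_zero]
  · intro M
    apply algebraMap_frac_injective
    rw [map_sum, algebraMap_walkGF hℓ (by omega), foldedSeq_of_le hb,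
      ← chainSum_multisumWeight _ (by omega), ← sum_chainTerm _ _ _ (Nat.lt_succ_self M),
      Finset.mul_sum]
    exact Finset.sum_congr rfl fun N _ => algebraMap_qFalling_mul_bigNCoeff hℓ hb N M

/-! ### The `n`-form of the multisum -/

theorem bigN_succ_self {ℓ : ℕ} (n : Fin ℓ → ℕ) : bigN n (ℓ + 1) = 0 := by
  simp [bigN]

theorem coord_eq {ℓ : ℕ} (v : Fin ℓ → ℕ) {j : ℕ} (h1 : 1 ≤ j) (h2 : j ≤ ℓ) :
    coord v j = v ⟨j - 1, by omega⟩ := dif_pos ⟨h1, h2⟩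

/-- The map `(n_1, …, n_ℓ) ↦ (N_1, …, N_ℓ)`. -/
def tailSums {ℓ : ℕ} (n : Fin ℓ → ℕ) : Fin ℓ → ℕ := fun k => bigN n (k + 1)

theorem coord_tailSums {ℓ : ℕ} (n : Fin ℓ → ℕ) {j : ℕ} (h1 : 1 ≤ j) (h2 : j ≤ ℓ) :
    coord (tailSums n) j = bigN n j := by
  rw [coord_eq _ h1 h2, tailSums, show ((⟨j - 1, by omega⟩ : Fin ℓ) : ℕ) + 1 = j from
    Nat.sub_add_cancel h1]

theorem coord_eq_bigN_sub {ℓ : ℕ} (n : Fin ℓ → ℕ) {j : ℕ} (h : j ≤ ℓ) :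
    (coord n j : ℤ) = (bigN n j : ℤ) - (bigN n (j + 1) : ℤ) := by
  rw [bigN_eq_coord_add n h]
  push_cast
  ring

theorem tailSums_injective (ℓ : ℕ) : Function.Injective (tailSums (ℓ := ℓ)) := by
  intro n n' h
  have hN : ∀ j, 1 ≤ j → j ≤ ℓ + 1 → bigN n j = bigN n' j := by
    intro j h1 h2
    rcases h2.eq_or_lt with rfl | h2
    · rw [bigN_succ_self, bigN_succ_self]
    · rw [← coord_tailSums n h1 (by omega), h, coord_tailSums n' h1 (by omega)]
  funext k
  have hk := k.2
  have h1 : coord n (k + 1) = n k := coord_eq n (Nat.succ_pos k) hk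
  have h2 : coord n' (k + 1) = n' k := coord_eq n' (Nat.succ_pos k) hk
  have h3 := coord_eq_bigN_sub n (show (k : ℕ) + 1 ≤ ℓ from hk)
  have h4 := coord_eq_bigN_sub n' (show (k : ℕ) + 1 ≤ ℓ from hk)
  rw [hN _ (by omega) (by omega), hN _ (by omega) (by omega), ← h4, h1, h2] at h3
  exact_mod_cast h3

theorem exists_tailSums_eq {ℓ : ℕ} {N : Fin ℓ → ℕ}
    (h : ∀ j, 1 ≤ j → j < ℓ → coord N (j + 1) ≤ coord N j) : ∃ n, tailSums n = N := by
  refine ⟨fun k => coord N (k + 1) - coord N (k + 2), ?_⟩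
  set n : Fin ℓ → ℕ := fun k => coord N (k + 1) - coord N (k + 2) with hn
  -- The default value of `coord` makes the last difference equal to N_ℓ.
  have hz : coord N (ℓ + 1) = 0 := dif_neg (by omega)
  have key : ∀ m j, 1 ≤ j → j + m = ℓ + 1 → bigN n j = coord N j := by
    intro m
    induction m with
    | zero =>
      rintro j - rfl
      rw [hz, bigN_succ_self]
    | succ m ih =>
      intro j h1 hm
      rw [bigN_eq_coord_add n (by omega), ih (j + 1) (by omega) (by omega),
        coord_eq n h1 (by omega), hn]
      simp only
      rw [show j - 1 + 1 = j by omega, show j - 1 + 2 = j + 1 by omega]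
      refine Nat.sub_add_cancel ?_
      rcases (show j ≤ ℓ by omega).eq_or_lt with rfl | hj
      · rw [hz]
        exact Nat.zero_le _
      · exact h j h1 hj
  funext k
  have hk := k.2
  rw [tailSums, key (ℓ - k) _ (by omega) (by omega)]
  exact coord_eq N (Nat.succ_pos k) hk

theorem invQ_of_neg {m : ℤ} (h : m < 0) : invQ m = 0 := if_neg (by omega)

/-- Outside the range some N_j < N_{j+1}, and the convention 1/(q)_m = 0 for m < 0 kills the term.
The two multisums are thus reindexings of each other. -/
theorem bigNTerm_eq_zero {ℓ b : ℕ} {N : Fin ℓ → ℕ} (h : N ∉ Set.range (tailSums (ℓ := ℓ))) :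
    bigNTerm ℓ b N = 0 := by
  by_contra hne
  refine h (exists_tailSums_eq fun j h1 h2 => ?_)
  by_contra! hlt
  refine hne ?_
  rw [bigNTerm, Finset.prod_eq_zero (i := j) (Finset.mem_Icc.2 ⟨h1, by omega⟩)
    (invQ_of_neg (by omega))]
  simp

theorem sum_sq_add_eq (s : Finset ℕ) (f : ℕ → ℕ) :
    ∑ j ∈ s, (f j ^ 2 + f j) = 2 * ∑ j ∈ s, (f j + 1).choose 2 := by
  rw [Finset.mul_sum]
  refine Finset.sum_congr rfl fun j _ => ?_
  rw [Nat.choose_two_right, Nat.add_sub_cancel, Nat.mul_div_cancel' ?_]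
  · ring
  · rw [mul_comm]
    exact (Nat.even_mul_succ_self _).two_dvd

theorem twiceExponent_div_two {ℓ b : ℕ} (hb : b ≤ ℓ / 2) (n : Fin ℓ → ℕ) :
    twiceExponent b n / 2 = (∑ j ∈ Finset.Icc 1 ℓ, (bigN n j + 1).choose 2) -
      ∑ i ∈ Finset.Icc 1 b, bigN n (2 * i) := by
  -- Sum over i of n_{2i-1} + 2N_{2i} = N_{2i-1} + N_{2i}.
  have h1 : ∀ b, b ≤ ℓ / 2 → (∑ i ∈ Finset.Icc 1 b, coord n (2 * i - 1)) +
      2 * ∑ i ∈ Finset.Icc 1 b, bigN n (2 * i) = ∑ j ∈ Finset.Icc 1 (2 * b), bigN n j := by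
    intro b
    induction b with
    | zero => simp
    | succ b ih =>
      intro hb
      have := ih (by omega)
      rw [show 2 * (b + 1) = 2 * b + 1 + 1 by ring, Finset.sum_Icc_succ_top (by omega),
        Finset.sum_Icc_succ_top (by omega), Finset.sum_Icc_succ_top (by omega),
        Finset.sum_Icc_succ_top (by omega), bigN_eq_coord_add n (show 2 * b + 1 ≤ ℓ by omega),
        show 2 * (b + 1) - 1 = 2 * b + 1 by omega, ← this,
        show 2 * (b + 1) = 2 * b + 1 + 1 by ring]
      ring
  have h2 : ∑ j ∈ Finset.Icc 1 ℓ, bigN n j =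
      (∑ j ∈ Finset.Icc 1 (2 * b), bigN n j) + ∑ j ∈ Finset.Icc (2 * b + 1) ℓ, bigN n j := by
    rw [← Finset.sum_union]
    · congr 1
      ext x
      simp only [Finset.mem_union, Finset.mem_Icc]
      omega
    · rw [Finset.disjoint_left]
      intro x
      simp only [Finset.mem_Icc]
      omega
  have h3 := sum_sq_add_eq (Finset.Icc 1 ℓ) (bigN n)
  rw [Finset.sum_add_distrib, h2] at h3
  have := h1 b hb
  unfold twiceExponent
  omega

theorem bigNTerm_tailSums {ℓ b : ℕ} (hℓ : 1 ≤ ℓ) (hb : b ≤ ℓ / 2) (n : Fin ℓ → ℕ) :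
    bigNTerm ℓ b (tailSums n) = smallNTerm ℓ b n := by
  obtain ⟨k, rfl⟩ := Nat.exists_eq_add_of_le' hℓ
  have e1 : ∑ i ∈ Finset.Icc 1 (k + 1), (coord (tailSums n) i + 1).choose 2 =
      ∑ j ∈ Finset.Icc 1 (k + 1), (bigN n j + 1).choose 2 :=
    Finset.sum_congr rfl fun i hi => by
      rw [Finset.mem_Icc] at hi
      rw [coord_tailSums n hi.1 hi.2]
  have e2 : ∑ i ∈ Finset.Icc 1 b, coord (tailSums n) (2 * i) =
      ∑ i ∈ Finset.Icc 1 b, bigN n (2 * i) :=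
    Finset.sum_congr rfl fun i hi => by
      rw [Finset.mem_Icc] at hi
      rw [coord_tailSums n (by omega) (by omega)]
  have e3 : ∏ j ∈ Finset.Icc 1 k,
      invQ ((coord (tailSums n) j : ℤ) - (coord (tailSums n) (j + 1) : ℤ)) =
        ∏ j ∈ Finset.Icc 1 k, invQ (coord n j) :=
    Finset.prod_congr rfl fun i hi => by
      rw [Finset.mem_Icc] at hi
      rw [coord_tailSums n hi.1 (by omega), coord_tailSums n (by omega) (by omega),
        coord_eq_bigN_sub n (by omega)]
  have e4 : bigN n (k + 1) = coord n (k + 1) := by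
    rw [bigN_eq_coord_add n le_rfl, bigN_succ_self, add_zero]
  rw [bigNTerm, smallNTerm, twiceExponent_div_two hb, e1, e2, Nat.add_sub_cancel, e3,
    coord_tailSums n le_rfl (by omega), coord_tailSums n (by omega) le_rfl, e4,
    Finset.prod_Icc_succ_top (by omega)]

theorem hasSum_smallNTerm {ℓ b : ℕ} (hℓ : 1 ≤ ℓ) (hb : b ≤ ℓ / 2) :
    HasSum (smallNTerm ℓ b) (oneSubMulMk fun M => walkGF ℓ M b) := by
  rw [← funext (bigNTerm_tailSums hℓ hb)]
  exact ((tailSums_injective ℓ).hasSum_iff fun N hN => bigNTerm_eq_zero hN).2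
    (hasSum_bigNTerm hℓ hb)

theorem sExponent_neg_etaVec {ℓ b : ℕ} (hb : b ≤ ℓ / 2) (n : Fin ℓ → ℕ) :
    (sExponent (-etaVec ℓ b) n).toNat = twiceExponent b n / 2 := by
  have h1 : ∑ k, (-etaVec ℓ b) k * (n k : ℤ) =
      -((∑ k ∈ Finset.Icc 1 b, bigN n (2 * k) : ℕ) : ℤ) := by
    push_cast
    have : ∀ m ∈ Finset.Icc 1 b, (bigN n (2 * m) : ℤ) = ∑ k, deltaVec ℓ (2 * m) k * (n k : ℤ) :=
      fun m hm => (deltaVec_dot _ (by simp only [Finset.mem_Icc] at hm; omega) n).symm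
    rw [Finset.sum_congr rfl this, Finset.sum_comm, ← Finset.sum_neg_distrib]
    refine Finset.sum_congr rfl fun k _ => ?_
    simp [etaVec, Finset.sum_mul]
  rw [sExponent, h1, sum_sq_add_eq, Nat.mul_div_cancel_left _ two_pos, twiceExponent_div_two hb]
  omega

theorem hasSum_sTerm {ℓ b : ℕ} (hℓ : 1 ≤ ℓ) (hb : b ≤ ℓ / 2) :
    HasSum (sTerm ℓ 0 (-etaVec ℓ b)) (oneSubMulMk fun M => walkGF ℓ M b) := by
  convert hasSum_smallNTerm hℓ hb using 1
  funext n
  rw [sTerm, smallNTerm, sExponent_neg_etaVec hb, add_zero]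

theorem S_eq {ℓ b : ℕ} (hℓ : 1 ≤ ℓ) (hb : b ≤ ℓ / 2) :
    S ℓ 0 (-etaVec ℓ b) = oneSubMulMk fun M => walkGF ℓ M b :=
  (hasSum_sTerm hℓ hb).tsum_eq

/-! ### The diamond relations -/

/-- This symmetry gives equality of the series for the two opposite profiles, and folds the
relations at the middle. -/
theorem walkGF_sub {ℓ d : ℕ} (hℓ : 1 ≤ ℓ) (hd : d ≤ ℓ) (M : ℕ) :
    walkGF ℓ M (ℓ - d) = walkGF ℓ M d := by
  apply algebraMap_frac_injective
  rw [algebraMap_walkGF hℓ (Nat.sub_le _ _), algebraMap_walkGF hℓ hd, foldedSeq_sub hd]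

theorem walkGF_edge {ℓ : ℕ} (hℓ : 1 ≤ ℓ) (M : ℕ) :
    walkGF ℓ (M + 1) 0 - PowerSeries.X ^ (M + 1) * walkGF ℓ (M + 1) 1 =
      (1 - PowerSeries.X ^ (M + 1) * PowerSeries.X ^ (M + 1)) * walkGF ℓ M 0 := by
  apply algebraMap_frac_injective
  simp only [map_sub, map_mul, map_pow, map_one, algebraMap_X]
  rw [algebraMap_walkGF hℓ (Nat.zero_le _), algebraMap_walkGF hℓ hℓ,
    algebraMap_walkGF hℓ (Nat.zero_le _), qFac_succ]
  linear_combination qFac qFrac M * (1 - qFrac ^ (M + 1)) *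
    foldedSeq_edge qFrac_ne_zero qFrac_pow_ne_one hℓ M

theorem walkGF_interior {ℓ d : ℕ} (h : d + 2 ≤ ℓ) (M : ℕ) :
    (1 + PowerSeries.X ^ (M + 1) * PowerSeries.X ^ (M + 1)) * walkGF ℓ (M + 1) (d + 1) -
        PowerSeries.X ^ (M + 1) * (walkGF ℓ (M + 1) d + walkGF ℓ (M + 1) (d + 2)) =
      (1 - PowerSeries.X ^ (M + 1) * PowerSeries.X ^ (M + 1)) * walkGF ℓ M (d + 1) := by
  have hℓ : 1 ≤ ℓ := by omega
  apply algebraMap_frac_injective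
  simp only [map_sub, map_add, map_mul, map_pow, map_one, algebraMap_X]
  rw [algebraMap_walkGF hℓ (by omega), algebraMap_walkGF hℓ (by omega), algebraMap_walkGF hℓ h,
    algebraMap_walkGF hℓ (by omega), qFac_succ]
  linear_combination qFac qFrac M * (1 - qFrac ^ (M + 1)) *
    foldedSeq_interior qFrac_ne_zero qFrac_pow_ne_one h M

theorem shiftZ_oneSubMulMk (k : ℕ) (g : ℕ → PowerSeries ℤ) :
    shiftZ k (oneSubMulMk g) = (1 - z * q ^ k) * shiftZ k (PowerSeries.mk g) := by
  have e : shiftZ k z = z * q ^ k := by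
    rw [shiftZ, z, PowerSeries.rescale_X, q_pow, mul_comm]
  rw [oneSubMulMk, ← e]
  simp only [shiftZ, map_mul, map_sub, map_one]

/-- For F = (1 - z)G the quotient F(zq^k)/(1 - zq^k) is G(zq^k), so the diamond relations become
polynomial relations between the coefficients of G. -/
theorem shiftDiv_oneSubMulMk (k : ℕ) (g : ℕ → PowerSeries ℤ) :
    shiftDiv k (oneSubMulMk g) = shiftZ k (PowerSeries.mk g) := by
  rw [shiftDiv, shiftZ_oneSubMulMk, mul_right_comm,
    Ring.mul_inverse_cancel _ (isUnit_one_sub_zq k), one_mul]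

theorem diamondLHS_oneSubMulMk (g : ℕ → PowerSeries ℤ) :
    diamondLHS (oneSubMulMk g) = oneSubMulMk g + z * (q ^ 2 * shiftZ 2 (PowerSeries.mk g)) := by
  rw [diamondLHS, ← shiftDiv_oneSubMulMk 2, shiftDiv]
  ring

theorem coeff_shiftZ_mk (k : ℕ) (g : ℕ → PowerSeries ℤ) (M : ℕ) :
    PowerSeries.coeff M (shiftZ k (PowerSeries.mk g)) = PowerSeries.X ^ (k * M) * g M := by
  rw [shiftZ, PowerSeries.coeff_rescale, PowerSeries.coeff_mk, pow_mul]

theorem coeff_succ_diamondLHS (g : ℕ → PowerSeries ℤ) (M : ℕ) :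
    PowerSeries.coeff (M + 1) (diamondLHS (oneSubMulMk g)) =
      g (M + 1) - (1 - PowerSeries.X ^ (M + 1) * PowerSeries.X ^ (M + 1)) * g M := by
  rw [diamondLHS_oneSubMulMk, map_add, coeff_succ_oneSubMulMk, z, PowerSeries.coeff_succ_X_mul,
    q_pow, PowerSeries.coeff_C_mul, coeff_shiftZ_mk]
  ring

theorem coeff_zero_diamondLHS (g : ℕ → PowerSeries ℤ) :
    PowerSeries.coeff 0 (diamondLHS (oneSubMulMk g)) = g 0 := by
  rw [diamondLHS_oneSubMulMk, map_add, coeff_zero_oneSubMulMk, z, PowerSeries.coeff_zero_X_mul,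
    add_zero]

theorem diamondLHS_edge {ℓ : ℕ} (hℓ : 1 ≤ ℓ) :
    diamondLHS (oneSubMulMk fun M => walkGF ℓ M 0) =
      shiftDiv 1 (oneSubMulMk fun M => walkGF ℓ M 1) := by
  ext1 M
  rw [shiftDiv_oneSubMulMk, coeff_shiftZ_mk]
  cases M with
  | zero => simp [coeff_zero_diamondLHS, walkGF]
  | succ M =>
    rw [coeff_succ_diamondLHS, ← walkGF_edge hℓ]
    ring

theorem diamondLHS_interior {ℓ d : ℕ} (h : d + 2 ≤ ℓ) :
    diamondLHS (oneSubMulMk fun M => walkGF ℓ M (d + 1)) =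
      shiftDiv 1 (oneSubMulMk fun M => walkGF ℓ M d) +
        shiftDiv 1 (oneSubMulMk fun M => walkGF ℓ M (d + 2)) -
        shiftDiv 2 (oneSubMulMk fun M => walkGF ℓ M (d + 1)) := by
  ext1 M
  simp only [shiftDiv_oneSubMulMk, map_add, map_sub, coeff_shiftZ_mk]
  cases M with
  | zero => simp [coeff_zero_diamondLHS, walkGF]
  | succ M =>
    rw [coeff_succ_diamondLHS, ← walkGF_interior h]
    ring

theorem diamondRelations_S {ℓ : ℕ} (hℓ : 1 ≤ ℓ) :
    DiamondRelations ℓ fun i => S ℓ 0 (-etaVec ℓ i) where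
  edge := by
    have h1 : S ℓ 0 (-etaVec ℓ 1) = oneSubMulMk fun M => walkGF ℓ M 1 := by
      rcases hℓ.eq_or_lt with rfl | h
      -- For ℓ = 1 the vector δ_2 vanishes, and R_1 = R_0 matches the reflection of d = 1 to d = 0.
      · have e : etaVec 1 1 = etaVec 1 0 := by
          funext k
          simp [etaVec, deltaVec]
        rw [e, S_eq le_rfl (by omega)]
        congr 1
        funext M
        exact walkGF_sub le_rfl le_rfl M
      · exact S_eq hℓ (by omega)
    simp only [h1, S_eq hℓ (Nat.zero_le _)]
    exact diamondLHS_edge hℓ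
  interior i h1 h2 := by
    obtain ⟨d, rfl⟩ := Nat.exists_eq_add_of_le' h1
    simp only [Nat.add_sub_cancel]
    rw [S_eq hℓ (by omega), S_eq hℓ (by omega), S_eq hℓ (by omega)]
    exact diamondLHS_interior (by omega)
  middle_even he := by
    obtain ⟨d, rfl⟩ : ∃ d, ℓ = 2 * d + 2 := by
      obtain ⟨k, rfl⟩ := he
      exact ⟨k - 1, by omega⟩
    rw [show (2 * d + 2) / 2 = d + 1 by omega, Nat.add_sub_cancel, S_eq hℓ (by omega),
      S_eq hℓ (by omega), diamondLHS_interior (by omega)]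
    have e : (fun M => walkGF (2 * d + 2) M (d + 2)) = fun M => walkGF (2 * d + 2) M d := by
      funext M
      rw [← walkGF_sub hℓ (by omega), show 2 * d + 2 - (d + 2) = d by omega]
    rw [e, two_mul (shiftDiv _ _)]
  middle_odd ho h3 := by
    obtain ⟨d, rfl⟩ : ∃ d, ℓ = 2 * d + 3 := by
      obtain ⟨k, rfl⟩ := ho
      exact ⟨k - 1, by omega⟩
    rw [show (2 * d + 3 - 1) / 2 = d + 1 by omega, show (2 * d + 3 - 3) / 2 = d by omega,
      S_eq hℓ (by omega), S_eq hℓ (by omega), diamondLHS_interior (by omega)]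
    have e : (fun M => walkGF (2 * d + 3) M (d + 2)) = fun M => walkGF (2 * d + 3) M (d + 1) := by
      funext M
      rw [← walkGF_sub hℓ (by omega), show 2 * d + 3 - (d + 2) = d + 1 by omega]
    rw [e]

/-! ### Initial conditions at z = 0 and q = 0 -/

theorem constantCoeff_walkGF_succ {ℓ d : ℕ} (hd : d ≤ ℓ) (M : ℕ) :
    PowerSeries.constantCoeff (walkGF ℓ (M + 1) d) =
      PowerSeries.constantCoeff (walkGF ℓ M d) := by
  -- At q = 0 only the stationary step e = d survives.
  rw [walkGF, map_sum, Finset.sum_eq_single_of_mem d (Finset.mem_range.2 (by omega))]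
  · simp
  · intro e _ he
    have : d - e + (e - d) ≠ 0 := by omega
    rw [map_mul, map_pow, map_pow, PowerSeries.constantCoeff_X, zero_pow (Nat.succ_ne_zero M),
      zero_pow this, zero_mul]

theorem constantCoeff_oneSubMulMk_walkGF (ℓ d : ℕ) :
    PowerSeries.constantCoeff (oneSubMulMk fun M => walkGF ℓ M d) = 1 := by
  rw [← PowerSeries.coeff_zero_eq_constantCoeff_apply, coeff_zero_oneSubMulMk, walkGF]

theorem map_constantCoeff_oneSubMulMk_walkGF {ℓ d : ℕ} (hd : d ≤ ℓ) :
    PowerSeries.map PowerSeries.constantCoeff (oneSubMulMk fun M => walkGF ℓ M d) = 1 := by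
  ext M
  rw [PowerSeries.coeff_map]
  cases M with
  | zero => simp [coeff_zero_oneSubMulMk, walkGF]
  | succ M =>
    rw [coeff_succ_oneSubMulMk, map_sub, constantCoeff_walkGF_succ hd, sub_self,
      PowerSeries.coeff_one, if_neg (Nat.succ_ne_zero M)]

end TightCylindric

theorem mainTheorem1 (ℓ : ℕ) (hℓ : 1 ≤ ℓ) :
    (∀ b : ℕ, b ≤ ℓ / 2 →
      Summable (TightCylindric.tightTerm ![ℓ - b, b]) ∧
      Summable (TightCylindric.tightTerm ![b, ℓ - b]) ∧
      TightCylindric.T ![ℓ - b, b] = TightCylindric.T ![b, ℓ - b] ∧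
      HasSum (TightCylindric.smallNTerm ℓ b) (TightCylindric.T ![ℓ - b, b]) ∧
      HasSum (TightCylindric.bigNTerm ℓ b) (TightCylindric.T ![ℓ - b, b]) ∧
      HasSum (TightCylindric.sTerm ℓ 0 (-TightCylindric.etaVec ℓ b))
        (TightCylindric.T ![ℓ - b, b])) ∧
    TightCylindric.DiamondRelations ℓ
      (fun i => TightCylindric.S ℓ 0 (-TightCylindric.etaVec ℓ i)) ∧
    (∀ i : ℕ, i ≤ ℓ / 2 →
      PowerSeries.constantCoeff (TightCylindric.S ℓ 0 (-TightCylindric.etaVec ℓ i)) = 1 ∧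
      PowerSeries.map PowerSeries.constantCoeff
        (TightCylindric.S ℓ 0 (-TightCylindric.etaVec ℓ i)) = 1) := by
  open TightCylindric in
  refine ⟨fun b hb => ?_, diamondRelations_S hℓ, fun i hi => ?_⟩
  · have hbℓ : b ≤ ℓ := by omega
    have h1 : HasSum (tightTerm ![ℓ - b, b]) (oneSubMulMk fun M => walkGF ℓ M b) := by
      have := hasSum_tightTerm (ℓ - b) b
      rwa [Nat.sub_add_cancel hbℓ, funext fun M => walkGF_sub hℓ hbℓ M] at this
    have h2 : HasSum (tightTerm ![b, ℓ - b]) (oneSubMulMk fun M => walkGF ℓ M b) := by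
      have := hasSum_tightTerm b (ℓ - b)
      rwa [Nat.add_sub_cancel' hbℓ] at this
    have e1 : T ![ℓ - b, b] = oneSubMulMk fun M => walkGF ℓ M b := h1.tsum_eq
    have e2 : T ![b, ℓ - b] = oneSubMulMk fun M => walkGF ℓ M b := h2.tsum_eq
    rw [e1, e2]
    exact ⟨h1.summable, h2.summable, rfl, hasSum_smallNTerm hℓ hb, hasSum_bigNTerm hℓ hb,
      hasSum_sTerm hℓ hb⟩
  · rw [S_eq hℓ hi]
    exact ⟨constantCoeff_oneSubMulMk_walkGF ℓ i,
      map_constantCoeff_oneSubMulMk_walkGF (hi.trans (Nat.div_le_self _ _))⟩
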